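/- Let $\Omega\subset\mathbb R^3$ be a bounded domain with a Liapunov boundary (locally, after a rigid motion, $\Omega$ is the region below the graph of a $C^{1,\alpha}$ function, for some $0<\alpha\le 1$), let $1<p<\infty$ and $1/p+1/q=1$, and let $\omega,\epsilon,\mu\in\mathbb C\setminus\{0\}$. Let $\lambda\in\mathbb C$ satisfy $\lambda^2=\omega^2\epsilon\mu$ and $\operatorname{Im}\lambda\ge 0$. Let $\vec j\in W^{p,\operatorname{div}}(\Omega)$, i.e. $\vec j\in L^p(\Omega;\mathbb C^3)$ with weak divergence $\operatorname{div}\vec j\in L^p(\Omega)$, and put $\rho=\frac1{i\omega}\operatorname{div}\vec j$. Consider the time-harmonic Maxwell system in $\Omega$ $$\operatorname{curl}\vec H=-i\omega\epsilon\vec E+\vec j,\quad \operatorname{div}\vec H=0,\quad \operatorname{curl}\vec E=i\omega\mu\vec H,\quad \operatorname{div}\vec E=\rho/\epsilon .\qquad (*)$$ Let $\theta(\vec x)=-\frac{e^{i\lambda|\vec x|}}{4\pi|\vec x|}$ and, for $\vec x\in\Omega$, $$\vec T_{2,\pm\lambda}[\vec j](\vec x)=\int_\Omega\Big[\pm\lambda\,\theta(\vec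 x-\vec y)\,\vec j(\vec y)-(\operatorname{grad}\theta)(\vec x-\vec y)\times\vec j(\vec y)\Big]\,d\vec y .$$ For $\kappa\in\{\lambda,-\lambda\}$, a force-free field for the wave number $\kappa$ is a field $\vec u\in C^1(\Omega;\mathbb C^3)$ with $\operatorname{div}\vec u=0$ and $\operatorname{curl}\vec u+\kappa\vec u=0$ in $\Omega$. Then the integrals defining $\vec T_{2,\pm\lambda}[\vec j](\vec x)$ converge absolutely for almost every $\vec x\in\Omega$, the fields $\vec T_{2,\pm\lambda}[\vec j]$ belong to $L^p_{\rm loc}(\Omega)$, and the weak curls $\operatorname{curl}(\vec T_{2,\lambda}\pm\vec T_{2,-\lambda})[\vec j]$ exist in $\Omega$ and belong to $L^p_{\rm loc}(\Omega)$. Moreover, consider the representation, almost everywhere in $\Omega$, $$\vec E=\frac1{2i\omega\epsilon}\Big(2\vec j-\operatorname{curl}(\vec T_{2,\lambda}+\vec T_{2,-\lambda})[\vec j]\Big)+\frac1{2i\omega\epsilon}(\vec u-\vec v),$$ $$\vec H=-\frac1{2\lambda}\operatorname{curl}(\vec T_{2,\lambda}-\vec T_{2,-\lambda})[\vec j]+\frac1{2\lambda}(\vec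 u+\vec v).\qquad (**)$$ 1. A pair $(\vec E,\vec H)$ of complex vector fields on $\Omega$ belongs to $L^p_{\rm loc}(\Omega)$ and solves $(*)$ weakly (tested against all functions in $C_c^\infty(\Omega)$) if and only if $(**)$ holds for some force-free fields $\vec u$ and $\vec v$ for the wave numbers $\lambda$ and $-\lambda$, respectively. In particular, $(**)$ gives a weak solution for arbitrary such $\vec u,\vec v$. 2. A pair $(\vec E,\vec H)$ of fields in $L^p(\Omega)$ solves $(*)$ weakly, tested against all functions in $W^{1,q}_0(\Omega)$, if and only if $(**)$ holds for some force-free fields $\vec u$ and $\vec v$ for the wave numbers $\lambda$ and $-\lambda$, respectively. -/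

import Mathlib

open MeasureTheory Filter Topology
open scoped ENNReal NNReal

noncomputable section

namespace MaxwellWeak

/-- Real Euclidean three-space. -/
abbrev R3 := EuclideanSpace ℝ (Fin 3)

/-- The values of complex vector fields (purely vectorial biquaternions). -/
abbrev C3 := Fin 3 → ℂ

/-! ### Domains with a Liapunov boundary -/

/-- `Ω` is a bounded domain (nonempty, open, connected) whose boundary is a Liapunov surface:
for some `α ∈ (0, 1]`, near every boundary point and after a rigid motion, `Ω` is the region
below the graph of a `C¹` function of two variables with `α`-Hölder continuous derivative. -/
structure IsLiapunovDomain (Ω : Set R3) : Prop where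
  isOpen : IsOpen Ω
  isConnected : IsConnected Ω
  isBounded : Bornology.IsBounded Ω
  boundary : ∃ α : ℝ≥0, 0 < α ∧ α ≤ 1 ∧ ∀ x₀ ∈ frontier Ω,
    ∃ (R : R3 ≃ₗᵢ[ℝ] R3) (r h : ℝ) (C : ℝ≥0) (f : EuclideanSpace ℝ (Fin 2) → ℝ),
      0 < r ∧ 0 < h ∧ f 0 = 0 ∧ ContDiffOn ℝ 1 f (Metric.ball 0 r) ∧
      HolderOnWith C α (fderiv ℝ f) (Metric.ball 0 r) ∧
      ∀ y : R3, !₂[y 0, y 1] ∈ Metric.ball (0 : EuclideanSpace ℝ (Fin 2)) r → |y 2| < h →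
        (x₀ + R y ∈ Ω ↔ y 2 < f !₂[y 0, y 1])

/-! ### Classical vector calculus and force-free fields -/

/-- The gradient `(∂₁φ, ∂₂φ, ∂₃φ)` of a scalar function. -/
def grad (φ : R3 → ℂ) (x : R3) : C3 :=
  fun i => fderiv ℝ φ x (EuclideanSpace.single i 1)

/-- The partial derivative `∂ᵢ uₖ` of a vector field. -/
def partialDeriv (u : R3 → C3) (i k : Fin 3) (x : R3) : ℂ :=
  fderiv ℝ u x (EuclideanSpace.single i 1) k

/-- The classical divergence. -/
def divergence (u : R3 → C3) (x : R3) : ℂ :=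
  ∑ i, partialDeriv u i i x

/-- The classical curl. -/
def curl (u : R3 → C3) (x : R3) : C3 :=
  ![partialDeriv u 1 2 x - partialDeriv u 2 1 x,
    partialDeriv u 2 0 x - partialDeriv u 0 2 x,
    partialDeriv u 0 1 x - partialDeriv u 1 0 x]

/-- Force-free fields for the wave number `κ`: purely vectorial `C¹` solutions in `Ω` of
`(D + κ) u = 0`, whose scalar part is `-div u` and whose vector part is `curl u + κ u`. -/
structure IsForceFree (Ω : Set R3) (κ : ℂ) (u : R3 → C3) : Prop where
  contDiffOn : ContDiffOn ℝ 1 u Ω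
  div_eq : ∀ x ∈ Ω, divergence u x = 0
  curl_eq : ∀ x ∈ Ω, curl u x + κ • u x = 0

/-! ### Test functions and weak derivatives -/

/-- Pairs `(φ, grad φ)` with `φ` a smooth function compactly supported in `Ω`. -/
def smoothTests (Ω : Set R3) : Set ((R3 → ℂ) × (R3 → C3)) :=
  {t | ContDiff ℝ (⊤ : ℕ∞) t.1 ∧ HasCompactSupport t.1 ∧ tsupport t.1 ⊆ Ω ∧ t.2 = grad t.1}

/-- Pairs `(v, grad v)` with `v ∈ W₀^{1,q}(Ω)`, the closure of the smooth compactly supported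
functions in the norm of `W^{1,q}(Ω)`. -/
def sobolevTests (Ω : Set R3) (q : ℝ≥0∞) : Set ((R3 → ℂ) × (R3 → C3)) :=
  {t | MemLp t.1 q (volume.restrict Ω) ∧ MemLp t.2 q (volume.restrict Ω) ∧
    ∃ φ : ℕ → R3 → ℂ, (∀ n, (φ n, grad (φ n)) ∈ smoothTests Ω) ∧
      Tendsto (fun n => eLpNorm (φ n - t.1) q (volume.restrict Ω)) atTop (𝓝 0) ∧
      Tendsto (fun n => eLpNorm (grad (φ n) - t.2) q (volume.restrict Ω)) atTop (𝓝 0)}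

/-- `curl F = G` in `Ω` weakly, against all test pairs `(v, grad v)` in `T`. -/
def WeakCurl (T : Set ((R3 → ℂ) × (R3 → C3))) (Ω : Set R3) (F G : R3 → C3) : Prop :=
  ∀ t ∈ T, ∫ x in Ω, t.1 x • G x = -∫ x in Ω, crossProduct (t.2 x) (F x)

/-- `div F = d` in `Ω` weakly, against all test pairs `(v, grad v)` in `T`. -/
def WeakDiv (T : Set ((R3 → ℂ) × (R3 → C3))) (Ω : Set R3) (F : R3 → C3) (d : R3 → ℂ) : Prop :=
  ∀ t ∈ T, ∫ x in Ω, t.1 x * d x = -∫ x in Ω, t.2 x ⬝ᵥ F x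

/-- `F ∈ L^p_loc(Ω)`. -/
def MemLpLoc (F : R3 → C3) (p : ℝ≥0∞) (Ω : Set R3) : Prop :=
  ∀ K ⊆ Ω, IsCompact K → MemLp F p (volume.restrict K)

/-- `W^{p,div}(Ω)`: fields in `L^p(Ω)` whose weak divergence `d` is in `L^p(Ω)`. -/
def MemWDiv (Ω : Set R3) (p : ℝ≥0∞) (F : R3 → C3) (d : R3 → ℂ) : Prop :=
  MemLp F p (volume.restrict Ω) ∧ MemLp d p (volume.restrict Ω) ∧
    WeakDiv (smoothTests Ω) Ω F d

/-! ### The Teodorescu component operators -/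

/-- The fundamental solution `θ(x) = -exp(iλ|x|) / (4π|x|)` of `Δ + λ²`. -/
def theta (lam : ℂ) (x : R3) : ℂ :=
  -Complex.exp (Complex.I * lam * ‖x‖) / (4 * Real.pi * ‖x‖)

/-- The vector part `-grad θ(x) = θ(x) (x/|x|² - iλ x/|x|)` of both kernels `E_{±λ}`. -/
def vecE (lam : ℂ) (x : R3) : C3 :=
  fun k => theta lam x * ((x k : ℂ) / (‖x‖ : ℂ) ^ 2 - Complex.I * lam * (x k : ℂ) / (‖x‖ : ℂ))

/-- The integrand `Sc E_κ(x-y) w(y) + Vec E_κ(x-y) × w(y)` of `T_{2,κ}[w](x)`, for `κ = ±λ`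
(both signs use the same `θ`), where `Sc E_κ = κ θ`. -/
def teodorescuIntegrand (lam κ : ℂ) (w : R3 → C3) (x y : R3) : C3 :=
  (κ * theta lam (x - y)) • w y + crossProduct (vecE lam (x - y)) (w y)

/-- The operator `T_{2,κ}` over `Ω`, for `κ = ±λ`. -/
def teodorescuTwo (Ω : Set R3) (lam κ : ℂ) (w : R3 → C3) (x : R3) : C3 :=
  ∫ y in Ω, teodorescuIntegrand lam κ w x y

/-! ### The time-harmonic Maxwell system -/

/-- The system `curl H = -iωε E + j`, `div H = 0`, `curl E = iωμ H`, `div E = ρ/ε` in `Ω`,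
in the weak sense against the test pairs in `T`. -/
structure WeakMaxwell (T : Set ((R3 → ℂ) × (R3 → C3))) (Ω : Set R3) (ω ε μ : ℂ)
    (ρ : R3 → ℂ) (j E H : R3 → C3) : Prop where
  curl_H : WeakCurl T Ω H (fun x => -(Complex.I * ω * ε) • E x + j x)
  div_H : WeakDiv T Ω H (fun _ => 0)
  curl_E : WeakCurl T Ω E (fun x => (Complex.I * ω * μ) • H x)
  div_E : WeakDiv T Ω E (fun x => ρ x / ε)

/-- The representation of `(E, H)` (almost everywhere in `Ω`) by `j`, by
`S = curl (T_{2,λ} + T_{2,-λ})[j]`, `Δ = curl (T_{2,λ} - T_{2,-λ})[j]` and by some force-free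
fields `u`, `v` for the wave numbers `λ`, `-λ`. -/
def HasRepresentation (Ω : Set R3) (ω ε lam : ℂ) (j S Δ E H : R3 → C3) : Prop :=
  ∃ u v : R3 → C3, IsForceFree Ω lam u ∧ IsForceFree Ω (-lam) v ∧
    (∀ᵐ x ∂(volume.restrict Ω),
      E x = (1 / (2 * Complex.I * ω * ε)) • ((2 : ℂ) • j x - S x)
        + (1 / (2 * Complex.I * ω * ε)) • (u x - v x)) ∧
    (∀ᵐ x ∂(volume.restrict Ω),
      H x = -((1 / (2 * lam)) • Δ x) + (1 / (2 * lam)) • (u x + v x))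

end MaxwellWeak

end

/-!
Let `V` be the volume potential of `j`, so that `(Δ + λ²) V = j` in `Ω`; since `Ω` is bounded, `θ`
may be replaced by a compactly supported parametrix `χ θ` with `χ = 1` on `Ω - Ω`. For `κ = ±λ` the
operator of the theorem is `T κ = κ V - curl V`, and `curl curl = grad div - Δ` turns
`S κ = curl (T κ)` into a field with `curl (j - S κ) = κ S κ`. Hence the two combinations
`u = λ H + i ω ε E - (j - S λ)` and `v = λ H - i ω ε E + (j - S (-λ))` decouple the Maxwell system
into `curl u + λ u = 0` and `curl v - λ v = 0`. Distributional solutions of these equations satisfy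
the Helmholtz equation, hence are smooth by Weyl's lemma (again via the parametrix): they are
force-free fields.

That `S κ` is locally in `L^p` would in general need singular integrals. Here the only second
derivatives of `V` that matter are `grad (div V)`, and since `div j ∈ L^p` one derivative can be
moved onto `j`: after localisation by a cutoff, only weakly singular kernels and Young's inequality
are used. For fields in `L^p`, Sobolev test functions are reached from smooth ones by Hölder's
inequality.
-/

noncomputable section

namespace MaxwellWeak

/-! ### Test functions -/

section TestFunctions

variable {E : Type*} [NormedAddCommGroup E] [NormedSpace ℝ E]

/-- `φ` is a smooth complex-valued function with compact support in `U`. -/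
structure IsTest (U : Set E) (φ : E → ℂ) : Prop where
  contDiff : ContDiff ℝ (⊤ : ℕ∞) φ
  hasCompactSupport : HasCompactSupport φ
  tsupport_subset : tsupport φ ⊆ U

/-- The directional derivative `∂ᵥφ`. -/
def dirDeriv (v : E) (φ : E → ℂ) (x : E) : ℂ := fderiv ℝ φ x v

lemma contDiff_dirDeriv {φ : E → ℂ} (hφ : ContDiff ℝ (⊤ : ℕ∞) φ) (v : E) :
    ContDiff ℝ (⊤ : ℕ∞) (dirDeriv v φ) :=
  (hφ.fderiv_right (m := (⊤ : ℕ∞)) le_rfl).clm_apply contDiff_const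

lemma continuousOn_dirDeriv {φ : E → ℂ} {U : Set E} (hφ : ContDiffOn ℝ 1 φ U) (hU : IsOpen U)
    (v : E) : ContinuousOn (dirDeriv v φ) U :=
  (hφ.continuousOn_fderiv_of_isOpen hU le_rfl).clm_apply continuousOn_const

lemma dirDeriv_comm {φ : E → ℂ} (hφ : ContDiff ℝ (⊤ : ℕ∞) φ) (v w : E) :
    dirDeriv v (dirDeriv w φ) = dirDeriv w (dirDeriv v φ) := by
  funext x
  have hd : DifferentiableAt ℝ (fderiv ℝ φ) x :=
    (hφ.fderiv_right (m := (⊤ : ℕ∞)) le_rfl).differentiable (by simp) x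
  have second (a b : E) : dirDeriv a (dirDeriv b φ) x = fderiv ℝ (fderiv ℝ φ) x a b := by
    unfold dirDeriv
    rw [fderiv_clm_apply hd (differentiableAt_const _)]
    simp
  rw [second, second]
  exact (hφ.contDiffAt.isSymmSndFDerivAt
    (by simpa using WithTop.coe_le_coe.2 (le_top : (2 : ℕ∞) ≤ ⊤))).eq v w

lemma dirDeriv_mul {φ ψ : E → ℂ} {x : E} (hφ : DifferentiableAt ℝ φ x)
    (hψ : DifferentiableAt ℝ ψ x) (v : E) :
    dirDeriv v (φ * ψ) x = dirDeriv v φ x * ψ x + φ x * dirDeriv v ψ x := by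
  simp only [dirDeriv, fderiv_mul hφ hψ, add_apply, smul_apply, smul_eq_mul]
  ring

lemma dirDeriv_comp_add_right (φ : E → ℂ) (v y : E) :
    dirDeriv v (fun x => φ (x + y)) = fun x => dirDeriv v φ (x + y) := by
  funext x
  simp [dirDeriv, fderiv_comp_add_right]

lemma dirDeriv_eventuallyEq_zero {φ : E → ℂ} {c : ℂ} {x : E} (h : φ =ᶠ[𝓝 x] fun _ => c) (v : E) :
    dirDeriv v φ =ᶠ[𝓝 x] fun _ => 0 :=
  h.eventuallyEq_nhds.mono fun y hy => by simp [dirDeriv, hy.fderiv_eq]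

namespace IsTest

variable {U V : Set E} {φ ψ : E → ℂ}

lemma continuous (h : IsTest U φ) : Continuous φ := h.contDiff.continuous

lemma differentiable (h : IsTest U φ) : Differentiable ℝ φ := h.contDiff.differentiable (by simp)

lemma mono (h : IsTest U φ) (hUV : U ⊆ V) : IsTest V φ :=
  ⟨h.contDiff, h.hasCompactSupport, h.tsupport_subset.trans hUV⟩

lemma eq_zero (h : IsTest U φ) {x : E} (hx : x ∉ U) : φ x = 0 :=
  image_eq_zero_of_notMem_tsupport fun hx' => hx (h.tsupport_subset hx')

lemma add (hφ : IsTest U φ) (hψ : IsTest U ψ) : IsTest U (φ + ψ) :=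
  ⟨hφ.contDiff.add hψ.contDiff, hφ.hasCompactSupport.add hψ.hasCompactSupport,
    (tsupport_add φ ψ).trans (Set.union_subset hφ.tsupport_subset hψ.tsupport_subset)⟩

lemma contDiff_mul (hφ : IsTest U φ) (hψ : ContDiff ℝ (⊤ : ℕ∞) ψ) : IsTest U (ψ * φ) :=
  ⟨hψ.mul hφ.contDiff, hφ.hasCompactSupport.mul_left,
    tsupport_mul_subset_right.trans hφ.tsupport_subset⟩

lemma dirDeriv (h : IsTest U φ) (v : E) : IsTest U (dirDeriv v φ) where
  contDiff := contDiff_dirDeriv h.contDiff v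
  hasCompactSupport := h.hasCompactSupport.fderiv_apply ℝ v
  tsupport_subset := (tsupport_fderiv_apply_subset ℝ v).trans h.tsupport_subset

lemma comp_add_right (h : IsTest U φ) (y : E) : IsTest Set.univ fun x => φ (x + y) :=
  ⟨h.contDiff.comp (contDiff_id.add contDiff_const),
    h.hasCompactSupport.comp_homeomorph (Homeomorph.addRight y), Set.subset_univ _⟩

section Integral

variable [MeasurableSpace E] {μ : Measure E}

lemma setIntegral_mul (h : IsTest U φ) (f : E → ℂ) :
    ∫ x in U, φ x * f x ∂μ = ∫ x, φ x * f x ∂μ :=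
  setIntegral_eq_integral_of_forall_compl_eq_zero fun x hx => by rw [h.eq_zero hx, zero_mul]

variable [BorelSpace E]

lemma integrable_mul (h : IsTest U φ) {f : E → ℂ} (hf : LocallyIntegrableOn f U μ) :
    Integrable (fun x => φ x * f x) μ := by
  have on_support : IntegrableOn (fun x => φ x * f x) (tsupport φ) μ :=
    (hf.integrableOn_compact_subset h.tsupport_subset h.hasCompactSupport).continuousOn_mul
      h.continuous.continuousOn h.hasCompactSupport
  refine (integrableOn_iff_integrable_of_support_subset fun x hx => ?_).1 on_support
  by_contra hx'
  exact hx (by simp [image_eq_zero_of_notMem_tsupport hx'])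

lemma integrable [IsFiniteMeasureOnCompacts μ] (h : IsTest U φ) : Integrable φ μ :=
  h.continuous.integrable_of_hasCompactSupport h.hasCompactSupport

end Integral

end IsTest

/-- The space `C_c^∞(U)` of test functions. -/
def testFunctions (U : Set E) : Submodule ℂ (E → ℂ) where
  carrier := {φ | IsTest U φ}
  add_mem' := IsTest.add
  zero_mem' := ⟨contDiff_const, HasCompactSupport.zero, by simp⟩
  smul_mem' c _ hφ := hφ.contDiff_mul (ψ := fun _ => c) contDiff_const

end TestFunctions

/-! ### Distributions -/

section Distributions

variable {E : Type*} [NormedAddCommGroup E] [NormedSpace ℝ E]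

/-- Linear functionals on test functions. Distributions are the continuous ones, but continuity
plays no role in the algebra of weak derivatives. -/
abbrev Distr (U : Set E) := Module.Dual ℂ (testFunctions U)

/-- The directional derivative as an operator on test functions. -/
def testDeriv (U : Set E) (v : E) : testFunctions U →ₗ[ℂ] testFunctions U where
  toFun φ := ⟨dirDeriv v φ, IsTest.dirDeriv φ.2 v⟩
  map_add' φ ψ := by
    ext x
    exact congrArg (· v) (fderiv_add (φ.2.differentiable x) (ψ.2.differentiable x))
  map_smul' c φ := by
    ext x
    exact congrArg (· v) (fderiv_const_smul (φ.2.differentiable x) c)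

/-- Multiplication by a smooth function as an operator on test functions. -/
def testMul (U : Set E) {η : E → ℂ} (hη : ContDiff ℝ (⊤ : ℕ∞) η) :
    testFunctions U →ₗ[ℂ] testFunctions U where
  toFun φ := ⟨η * φ, IsTest.contDiff_mul φ.2 hη⟩
  map_add' _ _ := Subtype.ext (mul_add ..)
  map_smul' _ _ := Subtype.ext (mul_smul_comm ..)

namespace Distr

variable {U : Set E}

/-- The weak directional derivative: `(∂ᵥT)(φ) = -T(∂ᵥφ)`. -/
def deriv (v : E) : Distr U →ₗ[ℂ] Distr U := -(testDeriv U v).dualMap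

lemma deriv_apply (v : E) (T : Distr U) (φ : testFunctions U) :
    deriv v T φ = -T (testDeriv U v φ) := rfl

lemma deriv_comm (v w : E) (T : Distr U) : deriv v (deriv w T) = deriv w (deriv v T) := by
  ext φ
  have : testDeriv U w (testDeriv U v φ) = testDeriv U v (testDeriv U w φ) :=
    Subtype.ext (dirDeriv_comm φ.2.contDiff w v)
  simp [deriv_apply, this]

/-- Multiplication of a distribution by a smooth function: `(ηT)(φ) = T(ηφ)`. -/
def mul {η : E → ℂ} (hη : ContDiff ℝ (⊤ : ℕ∞) η) : Distr U →ₗ[ℂ] Distr U := (testMul U hη).dualMap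

lemma mul_apply {η : E → ℂ} (hη : ContDiff ℝ (⊤ : ℕ∞) η) (T : Distr U) (φ : testFunctions U) :
    mul hη T φ = T (testMul U hη φ) := rfl

lemma deriv_mul {η : E → ℂ} (hη : ContDiff ℝ (⊤ : ℕ∞) η) (v : E) (T : Distr U) :
    deriv v (mul hη T) = mul (contDiff_dirDeriv hη v) T + mul hη (deriv v T) := by
  ext φ
  have leibniz : testDeriv U v (testMul U hη φ)
      = testMul U (contDiff_dirDeriv hη v) φ + testMul U hη (testDeriv U v φ) :=
    Subtype.ext (funext fun x =>
      dirDeriv_mul (hη.differentiable (by simp) x) (φ.2.differentiable x) v)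
  simp [deriv_apply, mul_apply, leibniz]

section Function

variable [MeasureSpace E] [BorelSpace E] {f g : E → ℂ}

open Classical in
/-- The distribution `φ ↦ ∫ φ f` of a function `f` that is locally integrable in `U`
(and `0` for all other `f`). -/
def ofFun (U : Set E) (f : E → ℂ) : Distr U :=
  if hf : LocallyIntegrableOn f U then
    { toFun := fun φ => ∫ x, φ.1 x * f x
      map_add' := fun φ ψ => by
        simp only [Submodule.coe_add, Pi.add_apply, add_mul]
        exact integral_add (φ.2.integrable_mul hf) (ψ.2.integrable_mul hf)
      map_smul' := fun c φ => by
        simp [mul_assoc, integral_const_mul] }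
  else 0

lemma ofFun_apply (hf : LocallyIntegrableOn f U) (φ : testFunctions U) :
    ofFun U f φ = ∫ x, φ.1 x * f x := by
  simp [ofFun, hf]

lemma deriv_ofFun_eq_iff (hf : LocallyIntegrableOn f U) (hg : LocallyIntegrableOn g U) {v : E} :
    deriv v (ofFun U f) = ofFun U g ↔
      ∀ φ, IsTest U φ → ∫ x, dirDeriv v φ x * f x = -∫ x, φ x * g x := by
  simp only [LinearMap.ext_iff, deriv_apply, ofFun_apply hf, ofFun_apply hg, neg_eq_iff_eq_neg]
  exact Subtype.forall

lemma ofFun_add (hf : LocallyIntegrableOn f U) (hg : LocallyIntegrableOn g U) :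
    ofFun U (f + g) = ofFun U f + ofFun U g := by
  ext φ
  rw [LinearMap.add_apply, ofFun_apply (hf.add hg), ofFun_apply hf, ofFun_apply hg,
    ← integral_add (φ.2.integrable_mul hf) (φ.2.integrable_mul hg)]
  simp only [Pi.add_apply, mul_add]

lemma ofFun_smul (hf : LocallyIntegrableOn f U) (c : ℂ) :
    ofFun U (c • f) = c • ofFun U f := by
  ext φ
  rw [LinearMap.smul_apply, ofFun_apply (hf.smul c), ofFun_apply hf, smul_eq_mul,
    ← integral_const_mul]
  simp only [Pi.smul_apply, smul_eq_mul, mul_left_comm]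

lemma ofFun_sub (hf : LocallyIntegrableOn f U) (hg : LocallyIntegrableOn g U) :
    ofFun U (f - g) = ofFun U f - ofFun U g := by
  rw [sub_eq_add_neg, ← neg_one_smul ℂ g, ofFun_add hf (hg.smul _), ofFun_smul hg,
    neg_one_smul, ← sub_eq_add_neg]

lemma ofFun_zero : ofFun U (0 : E → ℂ) = 0 := by
  simpa using ofFun_smul (f := 0) (locallyIntegrable_zero.locallyIntegrableOn U) 0

lemma ofFun_sum {ι : Type*} (s : Finset ι) {f : ι → E → ℂ}
    (hf : ∀ i, LocallyIntegrableOn (f i) U) :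
    ofFun U (∑ i ∈ s, f i) = ∑ i ∈ s, ofFun U (f i) := by
  classical
  have loc (s : Finset ι) : LocallyIntegrableOn (∑ i ∈ s, f i) U :=
    Finset.sum_induction f (LocallyIntegrableOn · U) (fun _ _ => .add)
      (locallyIntegrable_zero.locallyIntegrableOn U) fun i _ => hf i
  induction s using Finset.induction_on with
  | empty => simp [ofFun_zero]
  | insert i s hi ih =>
    rw [Finset.sum_insert hi, Finset.sum_insert hi, ofFun_add (hf i) (loc s), ih]

lemma locallyIntegrableOn_mul [FiniteDimensional ℝ E] (hU : IsOpen U)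
    (hf : LocallyIntegrableOn f U) {η : E → ℂ} (hη : ContDiff ℝ (⊤ : ℕ∞) η) :
    LocallyIntegrableOn (η * f) U :=
  hf.continuousOn_mul hη.continuous.continuousOn hU.isLocallyClosed

lemma mul_ofFun [FiniteDimensional ℝ E] (hU : IsOpen U) (hf : LocallyIntegrableOn f U) {η : E → ℂ}
    (hη : ContDiff ℝ (⊤ : ℕ∞) η) : mul hη (ofFun U f) = ofFun U (η * f) := by
  ext φ
  rw [mul_apply, ofFun_apply hf, ofFun_apply (locallyIntegrableOn_mul hU hf hη)]
  exact integral_congr_ae (ae_of_all _ fun x => by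
    simp only [testMul, LinearMap.coe_mk, AddHom.coe_mk, Pi.mul_apply]; ring)

lemma ofFun_congr (hU : MeasurableSet U) (hf : LocallyIntegrableOn f U)
    (hg : LocallyIntegrableOn g U) (h : f =ᵐ[volume.restrict U] g) : ofFun U f = ofFun U g := by
  ext φ
  rw [ofFun_apply hf, ofFun_apply hg]
  refine integral_congr_ae ?_
  filter_upwards [(ae_restrict_iff' hU).1 h] with x hx
  by_cases hxU : x ∈ U
  · rw [hx hxU]
  · simp [φ.2.eq_zero hxU]

variable [FiniteDimensional ℝ E]

lemma ae_eq_of_ofFun_eq (hU : IsOpen U) (hf : LocallyIntegrableOn f U)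
    (hg : LocallyIntegrableOn g U) (h : ofFun U f = ofFun U g) : f =ᵐ[volume.restrict U] g := by
  have sub_ae : ∀ᵐ x, x ∈ U → (f - g) x = 0 := by
    refine hU.ae_eq_zero_of_integral_contDiff_smul_eq_zero (hf.sub hg) fun η hη hc hs => ?_
    have test : IsTest U fun x => (η x : ℂ) :=
      ⟨Complex.ofRealCLM.contDiff.comp hη, hc.comp_left (g := Complex.ofReal) rfl,
        (closure_mono fun x hx => by simpa using hx : tsupport _ ⊆ tsupport η).trans hs⟩
    have := LinearMap.congr_fun h ⟨_, test⟩
    rw [ofFun_apply hf, ofFun_apply hg] at this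
    simpa [mul_sub, integral_sub (test.integrable_mul hf) (test.integrable_mul hg), sub_eq_zero]
      using this
  rw [EventuallyEq, ae_restrict_iff' hU.measurableSet]
  filter_upwards [sub_ae] with x hx hxU
  exact sub_eq_zero.1 (hx hxU)

variable [(volume : Measure E).IsAddHaarMeasure]

lemma deriv_ofFun (hU : IsOpen U) (hf : ContDiffOn ℝ 1 f U) (v : E) :
    deriv v (ofFun U f) = ofFun U (dirDeriv v f) := by
  have hfi : LocallyIntegrableOn f U := hf.continuousOn.locallyIntegrableOn hU.measurableSet
  have hdi : LocallyIntegrableOn (dirDeriv v f) U :=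
    (continuousOn_dirDeriv hf hU v).locallyIntegrableOn hU.measurableSet
  refine (deriv_ofFun_eq_iff hfi hdi).2 fun φ hφ => ?_
  rw [← neg_eq_iff_eq_neg, eq_comm]
  exact integral_mul_fderiv_eq_neg_fderiv_mul_of_integrable
    ((hφ.dirDeriv v).integrable_mul hfi) (hφ.integrable_mul hdi) (hφ.integrable_mul hfi)
    (fun x _ => hφ.differentiable x) fun x hx =>
      (hf.differentiableOn one_ne_zero).differentiableAt (hU.mem_nhds (hφ.tsupport_subset hx))

end Function

end Distr

end Distributions

/-! ### Convolution -/

local notation:67 f:68 " ⋆ " g:67 => convolution f g (ContinuousLinearMap.mul ℝ ℂ) volume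

section Convolution

variable {E : Type*} [NormedAddCommGroup E] [NormedSpace ℝ E] [MeasureSpace E] [BorelSpace E]

variable {N DN f φ : E → ℂ} {U : Set E}

lemma contDiff_convolution_of_isTest (hN : LocallyIntegrable N) (hφ : IsTest U φ) :
    ContDiff ℝ (⊤ : ℕ∞) (N ⋆ φ) :=
  hφ.hasCompactSupport.contDiff_convolution_right _ hN hφ.contDiff

open scoped Pointwise in
lemma IsTest.convolution (hφ : IsTest U φ) (hN : LocallyIntegrable N)
    (hc : HasCompactSupport N) : IsTest (tsupport N + U) (N ⋆ φ) where
  contDiff := contDiff_convolution_of_isTest hN hφ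
  hasCompactSupport := hc.convolution (ContinuousLinearMap.mul ℝ ℂ) hφ.hasCompactSupport
  tsupport_subset :=
    (closure_minimal ((support_convolution_subset _).trans
      (Set.add_subset_add (subset_tsupport N) (subset_tsupport φ)))
      (hc.isCompact.add hφ.hasCompactSupport.isCompact).isClosed).trans
      (Set.add_subset_add_left hφ.tsupport_subset)

variable [FiniteDimensional ℝ E] [(volume : Measure E).IsAddHaarMeasure]

lemma convolution_apply (N f : E → ℂ) (x : E) : (N ⋆ f) x = ∫ y, N (x - y) * f y :=
  convolution_eq_swap _

lemma dirDeriv_convolution (hN : LocallyIntegrable N) (hφ : IsTest U φ) (v : E) :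
    dirDeriv v (N ⋆ φ) = N ⋆ dirDeriv v φ := by
  funext x
  have h := hφ.hasCompactSupport.hasFDerivAt_convolution_right (ContinuousLinearMap.mul ℝ ℂ) hN
    (hφ.contDiff.of_le (by simp)) x
  rw [dirDeriv, h.fderiv, convolution_precompR_apply _ hN (hφ.hasCompactSupport.fderiv ℝ)
    (hφ.contDiff.continuous_fderiv (by simp))]
  rfl

lemma integral_mul_convolution (hφ : IsTest U φ) (hN : Integrable N) (hf : Integrable f) :
    ∫ x, φ x * (N ⋆ f) x = ∫ y, f y * ∫ x, φ (x + y) * N x := by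
  obtain ⟨C, hC⟩ := hφ.continuous.bounded_above_of_compact_support hφ.hasCompactSupport
  have joint : Integrable (Function.uncurry fun x y : E => φ x * (N (x - y) * f y))
      (volume.prod volume) := by
    have := hf.convolution_integrand (ContinuousLinearMap.mul ℝ ℂ) hN
    refine (this.congr ?_).bdd_mul (hφ.continuous.comp continuous_fst).aestronglyMeasurable
      (ae_of_all _ fun z => hC z.1)
    exact ae_of_all _ fun z => by simp [mul_comm]
  calc ∫ x, φ x * (N ⋆ f) x = ∫ x, ∫ y, φ x * (N (x - y) * f y) := by
        simp only [convolution_apply, integral_const_mul]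
    _ = ∫ y, ∫ x, φ x * (N (x - y) * f y) := integral_integral_swap joint
    _ = ∫ y, f y * ∫ x, φ (x + y) * N x := by
        congr with y
        rw [← integral_const_mul, ← integral_add_right_eq_self _ y]
        simp only [add_sub_cancel_right]
        congr with x
        ring

lemma reflect_convolution_apply (N φ : E → ℂ) (y : E) :
    ((fun z => N (-z)) ⋆ φ) y = ∫ x, φ (x + y) * N x := by
  rw [convolution_apply, ← integral_add_right_eq_self _ y]
  simp only [sub_add_cancel_right, neg_neg, mul_comm]

lemma integral_mul_convolution_eq_reflect (hφ : IsTest U φ) (hN : Integrable N)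
    (hf : Integrable f) :
    ∫ x, φ x * (N ⋆ f) x = ∫ y, ((fun z => N (-z)) ⋆ φ) y * f y := by
  simp only [integral_mul_convolution hφ hN hf, reflect_convolution_apply, mul_comm]

lemma Distr.deriv_ofFun_convolution (hN : Integrable N) (hDN : Integrable DN) {v : E}
    (h : Distr.deriv v (Distr.ofFun Set.univ N) = Distr.ofFun Set.univ DN) (hf : Integrable f) :
    Distr.deriv v (Distr.ofFun U (N ⋆ f)) = Distr.ofFun U (DN ⋆ f) := by
  have h' := (Distr.deriv_ofFun_eq_iff (hN.locallyIntegrable.locallyIntegrableOn _)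
    (hDN.locallyIntegrable.locallyIntegrableOn _)).1 h
  have loc {K : E → ℂ} (hK : Integrable K) : LocallyIntegrableOn (K ⋆ f) U :=
    (hK.integrable_convolution _ hf).locallyIntegrable.locallyIntegrableOn _
  refine (Distr.deriv_ofFun_eq_iff (loc hN) (loc hDN)).2 fun φ hφ => ?_
  rw [integral_mul_convolution (hφ.dirDeriv v) hN hf, integral_mul_convolution hφ hDN hf,
    ← integral_neg]
  congr with y
  rw [← mul_neg, ← h' _ (hφ.comp_add_right y), dirDeriv_comp_add_right]

/-! ### Young's inequality -/

lemma enorm_convolution_rpow_le {r : ℝ} (hr : 1 ≤ r) (hN : AEStronglyMeasurable N)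
    (hf : AEStronglyMeasurable f) (x : E) :
    ‖(N ⋆ f) x‖ₑ ^ r ≤ (∫⁻ y, ‖N y‖ₑ) ^ (r - 1) * ∫⁻ y, ‖N y‖ₑ * ‖f (x - y)‖ₑ ^ r := by
  have hr0 : 0 < r := by linarith
  set ν : Measure E := volume.withDensity fun y => ‖N y‖ₑ
  have hfx : AEStronglyMeasurable (fun y => f (x - y)) volume :=
    hf.comp_measurePreserving (Measure.measurePreserving_sub_left volume x)
  have lintegral_ν {F : E → ℝ≥0∞} (hF : AEMeasurable F) :
      ∫⁻ y, F y ∂ν = ∫⁻ y, ‖N y‖ₑ * F y :=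
    lintegral_withDensity_eq_lintegral_mul₀ hN.enorm hF
  have jensen := eLpNorm'_le_eLpNorm'_mul_rpow_measure_univ one_pos hr
    (hfx.mono_ac (withDensity_absolutelyContinuous _ _ : ν ≪ volume))
  rw [eLpNorm'_eq_lintegral_enorm, eLpNorm'_eq_lintegral_enorm] at jensen
  simp only [ENNReal.rpow_one, div_one] at jensen
  rw [lintegral_ν hfx.enorm, lintegral_ν (hfx.enorm.pow_const r),
    withDensity_apply _ MeasurableSet.univ, setLIntegral_univ] at jensen
  calc ‖(N ⋆ f) x‖ₑ ^ r ≤ (∫⁻ y, ‖N y‖ₑ * ‖f (x - y)‖ₑ) ^ r := by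
        gcongr
        refine (enorm_integral_le_lintegral_enorm _).trans_eq ?_
        simp
    _ ≤ ((∫⁻ y, ‖N y‖ₑ * ‖f (x - y)‖ₑ ^ r) ^ (1 / r) * (∫⁻ y, ‖N y‖ₑ) ^ (1 - 1 / r)) ^ r := by
        gcongr
    _ = _ := by
        rw [ENNReal.mul_rpow_of_nonneg _ _ hr0.le, ← ENNReal.rpow_mul, ← ENNReal.rpow_mul,
          one_div_mul_cancel hr0.ne', ENNReal.rpow_one, sub_mul, one_div_mul_cancel hr0.ne',
          one_mul, mul_comm]

lemma lintegral_enorm_convolution_rpow_le {r : ℝ} (hr : 1 ≤ r) (hN : AEStronglyMeasurable N)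
    (hf : AEStronglyMeasurable f) :
    ∫⁻ x, ‖(N ⋆ f) x‖ₑ ^ r ≤ (∫⁻ y, ‖N y‖ₑ) ^ r * ∫⁻ x, ‖f x‖ₑ ^ r := by
  have joint : AEMeasurable (fun z : E × E => ‖N z.2‖ₑ * ‖f (z.1 - z.2)‖ₑ ^ r)
      (volume.prod volume) :=
    hN.comp_snd.enorm.mul ((hf.comp_quasiMeasurePreserving
      (quasiMeasurePreserving_sub_of_right_invariant volume volume)).enorm.pow_const r)
  calc ∫⁻ x, ‖(N ⋆ f) x‖ₑ ^ r
      ≤ ∫⁻ x, (∫⁻ y, ‖N y‖ₑ) ^ (r - 1) * ∫⁻ y, ‖N y‖ₑ * ‖f (x - y)‖ₑ ^ r :=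
        lintegral_mono fun x => enorm_convolution_rpow_le hr hN hf x
    _ = (∫⁻ y, ‖N y‖ₑ) ^ (r - 1) * ∫⁻ y, ‖N y‖ₑ * ∫⁻ x, ‖f x‖ₑ ^ r := by
        rw [lintegral_const_mul'' _ joint.lintegral_prod_right', lintegral_lintegral_swap joint]
        refine congrArg _ (lintegral_congr fun y => ?_)
        rw [← lintegral_sub_right_eq_self (fun x => ‖f x‖ₑ ^ r) y]
        exact lintegral_const_mul' ‖N y‖ₑ _ enorm_ne_top
    _ = _ := by
        rw [lintegral_mul_const'' _ hN.enorm, ← mul_assoc]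
        nth_rw 2 [← ENNReal.rpow_one (∫⁻ y, ‖N y‖ₑ)]
        rw [← ENNReal.rpow_add_of_nonneg _ _ (by linarith) zero_le_one, sub_add_cancel]

theorem eLpNorm_convolution_le {p : ℝ≥0∞} (hp : 1 ≤ p) (hN : AEStronglyMeasurable N)
    (hf : AEStronglyMeasurable f) :
    eLpNorm (N ⋆ f) p volume ≤ eLpNorm N 1 volume * eLpNorm f p volume := by
  rcases eq_or_ne p ⊤ with rfl | hp_top
  · rw [eLpNorm_exponent_top, eLpNorm_exponent_top, eLpNorm_one_eq_lintegral_enorm]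
    refine eLpNormEssSup_le_of_ae_enorm_bound (ae_of_all _ fun x => ?_)
    rw [← lintegral_mul_const'' _ hN.enorm]
    refine (enorm_integral_le_lintegral_enorm _).trans (lintegral_mono_ae ?_)
    filter_upwards [(Measure.measurePreserving_sub_left volume x).quasiMeasurePreserving.ae
      (enorm_ae_le_eLpNormEssSup f volume)] with y hy
    simpa using mul_le_mul_right hy ‖N y‖ₑ
  · have hp0 : p ≠ 0 := (zero_lt_one.trans_le hp).ne'
    have hr : 1 ≤ p.toReal := by simpa using ENNReal.toReal_mono hp_top hp
    rw [eLpNorm_eq_lintegral_rpow_enorm_toReal hp0 hp_top,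
      eLpNorm_eq_lintegral_rpow_enorm_toReal hp0 hp_top, eLpNorm_one_eq_lintegral_enorm]
    refine (ENNReal.rpow_le_rpow (lintegral_enorm_convolution_rpow_le hr hN hf)
      (by positivity)).trans_eq ?_
    rw [ENNReal.mul_rpow_of_nonneg _ _ (by positivity), ← ENNReal.rpow_mul,
      mul_one_div_cancel (by linarith), ENNReal.rpow_one]

theorem memLp_convolution {p : ℝ≥0∞} (hp : 1 ≤ p) (hN : Integrable N) (hf : MemLp f p) :
    MemLp (N ⋆ f) p := by
  refine ⟨?_, (eLpNorm_convolution_le hp hN.1 hf.1).trans_lt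
    (ENNReal.mul_lt_top (memLp_one_iff_integrable.2 hN).2 hf.2)⟩
  exact (hN.1.convolution_integrand (ContinuousLinearMap.mul ℝ ℂ) hf.1).integral_prod_right'

end Convolution

/-! ### Integration in polar coordinates -/

section Ray

variable {E : Type*} [NormedAddCommGroup E] [NormedSpace ℝ E]

lemma integral_Ioi_deriv_ray {m m' : ℝ → ℂ} (hm : ∀ r, HasDerivAt m (m' r) r)
    (hm' : Continuous m') {U : Set E} {φ : E → ℂ} (hφ : IsTest U φ) {σ : E} (hσ : σ ≠ 0) :
    ∫ r in Set.Ioi (0 : ℝ), (m' r * φ (r • σ) + m r * fderiv ℝ φ (r • σ) σ)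
      = -(m 0 * φ 0) := by
  have ray : Topology.IsClosedEmbedding fun r : ℝ => r • σ := isClosedEmbedding_smul_left hσ
  have deriv_ray (r : ℝ) : HasDerivAt (fun r => φ (r • σ)) (fderiv ℝ φ (r • σ) σ) r := by
    have h := (hφ.differentiable (r • σ)).hasFDerivAt.comp_hasDerivAt r
      ((hasDerivAt_id r).smul_const σ)
    rwa [one_smul] at h
  have hmc : Continuous m := continuous_iff_continuousAt.2 fun r => (hm r).continuousAt
  have support_ray {ψ : E → ℂ} (hψ : IsTest U ψ) : HasCompactSupport fun r : ℝ => ψ (r • σ) :=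
    hψ.hasCompactSupport.comp_isClosedEmbedding ray
  have integrable_ray {g : ℝ → ℂ} {ψ : E → ℂ} (hg : Continuous g) (hψ : IsTest U ψ) :
      Integrable fun r => g r * ψ (r • σ) :=
    (hg.mul (hψ.continuous.comp ray.continuous)).integrable_of_hasCompactSupport
      (support_ray hψ).mul_left
  have key := integral_Ioi_of_hasDerivAt_of_tendsto' (a := 0)
    (fun r _ => (hm r).mul (deriv_ray r))
    ((integrable_ray hm' hφ).add (integrable_ray hmc (hφ.dirDeriv σ))).integrableOn
    (((support_ray hφ).mul_left (f := m)).is_zero_at_infty.mono_left atTop_le_cocompact)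
  simpa using key

end Ray

section Polar

variable {E : Type*} [NormedAddCommGroup E] [NormedSpace ℝ E] [Nontrivial E]
  [FiniteDimensional ℝ E] [MeasureSpace E] [BorelSpace E] [(volume : Measure E).IsAddHaarMeasure]

local notation "dim" => Module.finrank ℝ E

lemma integral_eq_integral_sphere_integral_Ioi {f : E → ℂ} (hf : Integrable f) :
    ∫ x, f x = ∫ σ : Metric.sphere (0 : E) 1,
      (∫ r in Set.Ioi (0 : ℝ), (r : ℂ) ^ (dim - 1) * f (r • (σ : E))) ∂volume.toSphere := by
  have mp := (volume : Measure E).measurePreserving_homeomorphUnitSphereProd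
  have emb := (homeomorphUnitSphereProd E).measurableEmbedding
  set F : Metric.sphere (0 : E) 1 × Set.Ioi (0 : ℝ) → ℂ := fun z => f ((z.2 : ℝ) • (z.1 : E))
  have F_polar (x : ({0}ᶜ : Set E)) : F (homeomorphUnitSphereProd E x) = f x := by
    have hx : ‖(x : E)‖ ≠ 0 := norm_ne_zero_iff.2 x.2
    simp [F, homeomorphUnitSphereProd, smul_smul, hx]
  have F_integrable : Integrable F (volume.toSphere.prod (Measure.volumeIoiPow (dim - 1))) := by
    rw [← mp.integrable_comp_emb emb]
    refine Integrable.congr ?_ (ae_of_all _ fun x => (F_polar x).symm)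
    exact (integrableOn_iff_comap_subtypeVal (measurableSet_singleton 0).compl).1 hf.integrableOn
  calc ∫ x, f x = ∫ x : ({0}ᶜ : Set E), f x ∂(volume.comap Subtype.val) := by
        rw [integral_subtype_comap (measurableSet_singleton _).compl f, restrict_compl_singleton]
    _ = ∫ z, F z ∂(volume.toSphere.prod (Measure.volumeIoiPow (dim - 1))) := by
        rw [← mp.integral_comp emb F]
        simp only [F_polar]
    _ = ∫ σ, ∫ r, F (σ, r) ∂(Measure.volumeIoiPow (dim - 1)) ∂volume.toSphere :=
        integral_prod F F_integrable
    _ = _ := by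
        congr with σ
        simp only [Measure.volumeIoiPow, ENNReal.ofReal]
        rw [integral_withDensity_eq_integral_smul (by fun_prop),
          integral_subtype_comap measurableSet_Ioi
            fun r : ℝ => Real.toNNReal (r ^ (dim - 1)) • f (r • (σ : E))]
        refine setIntegral_congr_fun measurableSet_Ioi fun r hr => ?_
        simp [NNReal.smul_def, Real.coe_toNNReal _ (pow_nonneg (Set.mem_Ioi.1 hr).le _)]

lemma locallyIntegrable_inv_norm_pow {k : ℕ} (hk : k < dim) :
    LocallyIntegrable fun x : E => (‖x‖ ^ k)⁻¹ := by
  intro x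
  refine ⟨Metric.ball 0 (‖x‖ + 1), Metric.isOpen_ball.mem_nhds (by simp), ?_⟩
  refine integrableOn_ball_of_norm_le_rpow (C := 1) (α := k) Module.finrank_pos
    (by exact_mod_cast hk) (ae_of_all _ fun y => ?_) (by fun_prop)
  simp [Real.rpow_neg]

lemma locallyIntegrable_of_norm_le {f : E → ℂ} {g : E → ℝ} {k : ℕ} (hk : k < dim)
    (hf : AEStronglyMeasurable f) (hg : Continuous g) (h : ∀ x, ‖f x‖ ≤ g x * (‖x‖ ^ k)⁻¹) :
    LocallyIntegrable f :=
  ((locallyIntegrable_inv_norm_pow hk).continuous_mul hg).mono hf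
    (ae_of_all _ fun x => (h x).trans (le_abs_self _))

lemma integrable_of_norm_le {f : E → ℂ} {g : E → ℝ} {k : ℕ} (hk : k < dim)
    (hf : AEStronglyMeasurable f) (hg : Continuous g) (hgc : HasCompactSupport g)
    (h : ∀ x, ‖f x‖ ≤ g x * (‖x‖ ^ k)⁻¹) : Integrable f :=
  ((locallyIntegrable_inv_norm_pow hk).integrable_smul_left_of_hasCompactSupport hg hgc).mono' hf
    (ae_of_all _ h)

lemma aestronglyMeasurable_radial {E : Type*} [NormedAddCommGroup E] [MeasureSpace E]
    [BorelSpace E] {g : ℝ → ℂ} (hg : Continuous g) (k : ℕ) :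
    AEStronglyMeasurable fun x : E => g ‖x‖ * ((‖x‖ : ℂ) ^ k)⁻¹ :=
  (hg.comp continuous_norm).aestronglyMeasurable.mul
    (Measurable.aestronglyMeasurable (by fun_prop))

lemma integrable_radial_mul {g : ℝ → ℂ} (hg : Continuous g) {k : ℕ} (hk : k < dim) {U : Set E}
    {φ : E → ℂ} (hφ : IsTest U φ) : Integrable fun x => g ‖x‖ * ((‖x‖ : ℂ) ^ k)⁻¹ * φ x := by
  refine integrable_of_norm_le (g := fun x => ‖g ‖x‖‖ * ‖φ x‖) hk
    ((aestronglyMeasurable_radial hg k).mul hφ.continuous.aestronglyMeasurable)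
    ((hg.comp continuous_norm).norm.mul hφ.continuous.norm) hφ.hasCompactSupport.norm.mul_left
    fun x => le_of_eq ?_
  simp only [norm_mul, norm_inv, norm_pow, Complex.norm_real, norm_norm, mul_right_comm]

lemma integrable_radial_mul_fderiv {g : ℝ → ℂ} (hg : Continuous g) {U : Set E} {φ : E → ℂ}
    (hφ : IsTest U φ) : Integrable fun x => g ‖x‖ * ((‖x‖ : ℂ) ^ dim)⁻¹ * fderiv ℝ φ x x := by
  have hφ' : Continuous (fderiv ℝ φ) := hφ.contDiff.continuous_fderiv (by simp)
  have pow_dim_inv_mul (x : E) : (‖x‖ ^ dim)⁻¹ * ‖x‖ ≤ (‖x‖ ^ (dim - 1))⁻¹ := by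
    rw [← pow_sub_one_mul (Module.finrank_pos (R := ℝ) (M := E)).ne', mul_inv, mul_assoc]
    exact mul_le_of_le_one_right (by positivity) inv_mul_le_one
  refine integrable_of_norm_le (k := dim - 1) (g := fun x => ‖g ‖x‖‖ * ‖fderiv ℝ φ x‖)
    (Nat.sub_one_lt Module.finrank_pos.ne')
    ((aestronglyMeasurable_radial hg _).mul (hφ'.clm_apply continuous_id).aestronglyMeasurable)
    (by fun_prop) (hφ.hasCompactSupport.fderiv ℝ).norm.mul_left fun x => ?_
  calc _ ≤ ‖g ‖x‖‖ * (‖x‖ ^ dim)⁻¹ * (‖fderiv ℝ φ x‖ * ‖x‖) := by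
        simp only [norm_mul, norm_inv, norm_pow, Complex.norm_real, norm_norm]
        gcongr
        exact (fderiv ℝ φ x).le_opNorm x
    _ = ‖g ‖x‖‖ * ‖fderiv ℝ φ x‖ * ((‖x‖ ^ dim)⁻¹ * ‖x‖) := by ring
    _ ≤ _ := by gcongr; exact pow_dim_inv_mul x

theorem integral_radial_mul_fderiv {m m' : ℝ → ℂ} (hm : ∀ r, HasDerivAt m (m' r) r)
    (hm' : Continuous m') {U : Set E} {φ : E → ℂ} (hφ : IsTest U φ) :
    ∫ x, m ‖x‖ * ((‖x‖ : ℂ) ^ dim)⁻¹ * fderiv ℝ φ x x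
      = -((volume : Measure E).toSphere.real Set.univ * (m 0 * φ 0))
        - ∫ x, m' ‖x‖ * ((‖x‖ : ℂ) ^ (dim - 1))⁻¹ * φ x := by
  have dim_pos : 0 < dim := Module.finrank_pos
  have int_left := integrable_radial_mul_fderiv
    (continuous_iff_continuousAt.2 fun r => (hm r).continuousAt) hφ
  have int_right := integrable_radial_mul hm' (Nat.sub_one_lt dim_pos.ne') hφ
  have on_ray (σ : Metric.sphere (0 : E) 1) : ∫ r in Set.Ioi (0 : ℝ), (r : ℂ) ^ (dim - 1) *
      (m' ‖r • (σ : E)‖ * ((‖r • (σ : E)‖ : ℂ) ^ (dim - 1))⁻¹ * φ (r • (σ : E))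
        + m ‖r • (σ : E)‖ * ((‖r • (σ : E)‖ : ℂ) ^ dim)⁻¹ * fderiv ℝ φ (r • (σ : E)) (r • (σ : E)))
      = -(m 0 * φ 0) := by
    rw [← integral_Ioi_deriv_ray hm hm' hφ (ne_zero_of_mem_unit_sphere σ)]
    refine setIntegral_congr_fun measurableSet_Ioi fun r (hr : 0 < r) => ?_
    have hr' : (r : ℂ) ≠ 0 := by exact_mod_cast hr.ne'
    simp only [norm_smul, norm_eq_of_mem_sphere, mul_one, Real.norm_of_nonneg hr.le, map_smul,
      ← pow_sub_one_mul dim_pos.ne' (r : ℂ), Complex.real_smul]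
    field_simp
  rw [eq_sub_iff_add_eq']
  refine (integral_add int_right int_left).symm.trans ?_
  refine (integral_eq_integral_sphere_integral_Ioi (int_right.add int_left)).trans ?_
  simp only [Pi.add_apply, on_ray, integral_const, Complex.real_smul, mul_neg]

end Polar

/-! ### Removable singularities -/

section Removable

variable {E : Type*} [NormedAddCommGroup E] [NormedSpace ℝ E] [FiniteDimensional ℝ E]

lemma exists_contDiff_zero_near_zero : ∃ ψ : E → ℂ, ContDiff ℝ (⊤ : ℕ∞) ψ ∧
    (∀ x, ‖x‖ < 1 → ψ =ᶠ[𝓝 x] fun _ => 0) ∧ (∀ x, 2 < ‖x‖ → ψ =ᶠ[𝓝 x] fun _ => 1) ∧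
    ∀ x, ‖ψ x‖ ≤ 1 := by
  let χ : ContDiffBump (0 : E) := ⟨1, 2, one_pos, one_lt_two⟩
  refine ⟨fun x => ((1 - χ x : ℝ) : ℂ),
    Complex.ofRealCLM.contDiff.comp (contDiff_const.sub χ.contDiff), fun x hx => ?_,
    fun x hx => ?_, fun x => ?_⟩
  · filter_upwards [χ.eventuallyEq_one_of_mem_ball (mem_ball_zero_iff.2 hx)] with y hy
    simp [hy]
  · filter_upwards [(isOpen_lt continuous_const continuous_norm).mem_nhds hx] with y hy
    simp [χ.zero_of_le_dist (show χ.rOut ≤ dist y 0 by simpa [χ] using le_of_lt hy)]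
  · rw [Complex.norm_real, Real.norm_of_nonneg (sub_nonneg.2 χ.le_one)]
    exact sub_le_self 1 χ.nonneg

lemma exists_cutoff (v : E) : ∃ (ζ : ℕ → E → ℂ) (C : ℝ), (∀ n, ContDiff ℝ (⊤ : ℕ∞) (ζ n)) ∧
    (∀ n, ζ n =ᶠ[𝓝 0] fun _ => 0) ∧ (∀ x ≠ 0, ∀ᶠ n in atTop, ζ n =ᶠ[𝓝 x] fun _ => 1) ∧
    (∀ n x, ‖ζ n x‖ ≤ 1) ∧ ∀ n x, ‖dirDeriv v (ζ n) x‖ ≤ C * ‖x‖⁻¹ := by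
  obtain ⟨ψ, ψ_smooth, ψ_inner, ψ_outer, ψ_le⟩ := exists_contDiff_zero_near_zero (E := E)
  have ψ_deriv_support : HasCompactSupport (dirDeriv v ψ) := by
    refine HasCompactSupport.intro (isCompact_closedBall 0 2) fun x hx => ?_
    exact (dirDeriv_eventuallyEq_zero (ψ_outer x (by simpa using hx)) v).self_of_nhds
  obtain ⟨C, hC⟩ := (continuous_norm.smul
    (contDiff_dirDeriv ψ_smooth v).continuous).bounded_above_of_compact_support
      ψ_deriv_support.smul_left
  have scale (n : ℕ) (x : E) : Tendsto (fun y : E => ((n : ℝ) + 1) • y) (𝓝 x)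
      (𝓝 (((n : ℝ) + 1) • x)) := (continuous_const_smul _).tendsto _
  refine ⟨fun n x => ψ (((n : ℝ) + 1) • x), C, fun n => ψ_smooth.comp (contDiff_const_smul _),
    fun n => (scale n 0).eventually (ψ_inner _ (by simp)), fun x hx => ?_, fun n x => ψ_le _,
    fun n x => ?_⟩
  · filter_upwards [tendsto_natCast_atTop_atTop.eventually_gt_atTop (2 / ‖x‖)] with n hn
    refine (scale n x).eventually (ψ_outer _ ?_)
    rw [norm_smul, Real.norm_of_nonneg (by positivity)]
    linarith [(div_lt_iff₀ (norm_pos_iff.2 hx)).1 hn, norm_nonneg x]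
  · rw [dirDeriv, fderiv_comp_smul, ← div_eq_mul_inv]
    rcases eq_or_ne x 0 with rfl | hx
    · simp [(ψ_inner 0 (by simp)).fderiv_eq]
    · rw [le_div_iff₀ (norm_pos_iff.2 hx)]
      refine le_trans (le_of_eq ?_) (hC (((n : ℝ) + 1) • x))
      simp only [FunLike.coe_smul, Pi.smul_apply, norm_smul, Pi.smul_apply', norm_mul, norm_norm,
        dirDeriv]
      ring

variable [MeasureSpace E] [BorelSpace E] [(volume : Measure E).IsAddHaarMeasure]

lemma integral_cutoff_mul_eq_zero {f ζ φ : E → ℂ} {v : E} (hf : ContDiffOn ℝ 1 f {0}ᶜ)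
    (hfi : LocallyIntegrable f) (hdi : LocallyIntegrable (dirDeriv v f))
    (hζ : ContDiff ℝ (⊤ : ℕ∞) ζ) (hζ0 : ζ =ᶠ[𝓝 0] fun _ => 0) (hφ : IsTest Set.univ φ) :
    ∫ x, (ζ x * (dirDeriv v φ x * f x + φ x * dirDeriv v f x) + dirDeriv v ζ x * (φ x * f x))
      = 0 := by
  have test : IsTest {0}ᶜ (ζ * φ) := by
    refine ⟨hζ.mul hφ.contDiff, hφ.hasCompactSupport.mul_left, ?_⟩
    rintro _ hx rfl
    exact notMem_tsupport_iff_eventuallyEq.2 (hζ0.mono fun y hy => by simp [hy]) hx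
  have key := (Distr.deriv_ofFun_eq_iff (hfi.locallyIntegrableOn _)
    (hdi.locallyIntegrableOn _)).1 (Distr.deriv_ofFun isOpen_compl_singleton hf v) _ test
  rw [eq_neg_iff_add_eq_zero, ← integral_add ((test.dirDeriv v).integrable_mul
    (hfi.locallyIntegrableOn _)) (test.integrable_mul (hdi.locallyIntegrableOn _))] at key
  rw [← key]
  congr with x
  simp only [dirDeriv_mul (hζ.differentiable (by simp) x) (hφ.differentiable x), Pi.mul_apply]
  ring

theorem Distr.deriv_ofFun_of_contDiffOn_compl_zero [Nontrivial E] {f : E → ℂ} {v : E}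
    (hf : ContDiffOn ℝ 1 f {0}ᶜ) (hfi : LocallyIntegrable f)
    (hdi : LocallyIntegrable (dirDeriv v f))
    (hsi : LocallyIntegrable fun x => (‖x‖ : ℂ)⁻¹ * f x) :
    Distr.deriv v (Distr.ofFun Set.univ f) = Distr.ofFun Set.univ (dirDeriv v f) := by
  obtain ⟨ζ, C, ζ_smooth, ζ_zero, ζ_one, ζ_le, ζ_deriv⟩ := exists_cutoff v
  refine (Distr.deriv_ofFun_eq_iff (hfi.locallyIntegrableOn _)
    (hdi.locallyIntegrableOn _)).2 fun φ hφ => ?_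
  have int_left := (hφ.dirDeriv v).integrable_mul (hfi.locallyIntegrableOn _)
  have int_right := hφ.integrable_mul (hdi.locallyIntegrableOn _)
  have int_φf := hφ.integrable_mul (hfi.locallyIntegrableOn _)
  have int_singular := hφ.integrable_mul (hsi.locallyIntegrableOn _)
  rw [eq_neg_iff_add_eq_zero, ← integral_add int_left int_right]
  have tends := tendsto_integral_of_dominated_convergence
    (F := fun n x => ζ n x * (dirDeriv v φ x * f x + φ x * dirDeriv v f x)
      + dirDeriv v (ζ n) x * (φ x * f x))
    (f := fun x => dirDeriv v φ x * f x + φ x * dirDeriv v f x)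
    (fun x => ‖dirDeriv v φ x * f x + φ x * dirDeriv v f x‖ + C * ‖φ x * ((‖x‖ : ℂ)⁻¹ * f x)‖)
    (fun n => (((ζ_smooth n).continuous.aestronglyMeasurable.mul (int_left.add int_right).1).add
      ((contDiff_dirDeriv (ζ_smooth n) v).continuous.aestronglyMeasurable.mul int_φf.1)))
    ((int_left.add int_right).norm.add (int_singular.norm.const_mul C))
    (fun n => ae_of_all _ fun x => ?_) ?_
  · simp only [integral_cutoff_mul_eq_zero hf hfi hdi (ζ_smooth _) (ζ_zero _) hφ] at tends
    exact tendsto_nhds_unique tends tendsto_const_nhds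
  · refine (norm_add_le _ _).trans (add_le_add ?_ ?_)
    · rw [norm_mul]
      exact mul_le_of_le_one_left (norm_nonneg _) (ζ_le n x)
    · calc _ ≤ C * ‖x‖⁻¹ * ‖φ x * f x‖ := by
            rw [norm_mul]
            gcongr
            exact ζ_deriv n x
        _ = _ := by simp only [norm_mul, norm_inv, Complex.norm_real, norm_norm]; ring
  · filter_upwards [compl_mem_ae_iff.2 (measure_singleton (0 : E))] with x hx
    refine tendsto_const_nhds.congr' ?_
    filter_upwards [ζ_one x hx] with n hn
    simp [hn.self_of_nhds, (dirDeriv_eventuallyEq_zero hn v).self_of_nhds]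

end Removable

/-! ### The fundamental solution of `Δ + λ²` -/

section FundamentalSolution

/-- The `i`-th vector of the standard basis of `R3`. -/
abbrev e (i : Fin 3) : R3 := EuclideanSpace.single i 1

lemma sum_smul_e (x : R3) : ∑ i, x i • e i = x := by
  simpa using (EuclideanSpace.basisFun (Fin 3) ℝ).sum_repr x

/-- `r² ∂θ/∂r`, which extends smoothly to `r = 0`. -/
def radialFlux (lam : ℂ) (r : ℝ) : ℂ :=
  (1 - Complex.I * lam * r) * Complex.exp (Complex.I * lam * r) / (4 * Real.pi)

lemma hasDerivAt_radialFlux (lam : ℂ) (r : ℝ) :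
    HasDerivAt (radialFlux lam)
      (lam ^ 2 * r * Complex.exp (Complex.I * lam * r) / (4 * Real.pi)) r := by
  have linear : HasDerivAt (fun r : ℝ => Complex.I * lam * r) (Complex.I * lam) r := by
    simpa using (Complex.ofRealCLM.hasDerivAt (x := r)).const_mul (Complex.I * lam)
  refine (((linear.const_sub 1).mul linear.cexp).div_const (4 * Real.pi : ℂ)).congr_deriv ?_
  rw [show lam ^ 2 = -(Complex.I * lam) ^ 2 by simp [mul_pow]]
  ring

variable (lam : ℂ)

lemma vecE_eq_radialFlux (x : R3) (i : Fin 3) :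
    vecE lam x i = -(radialFlux lam ‖x‖ * ((‖x‖ : ℂ) ^ 3)⁻¹ * x i) := by
  rcases eq_or_ne x 0 with rfl | hx
  · simp [vecE]
  have hx' : (‖x‖ : ℂ) ≠ 0 := by simpa using hx
  have hpi : (Real.pi : ℂ) ≠ 0 := by exact_mod_cast Real.pi_ne_zero
  simp only [vecE, theta, radialFlux]
  field_simp

lemma contDiffOn_theta : ContDiffOn ℝ (⊤ : ℕ∞) (theta lam) {0}ᶜ := by
  intro x (hx : x ≠ 0)
  have hpi : (Real.pi : ℂ) ≠ 0 := by exact_mod_cast Real.pi_ne_zero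
  have norm : ContDiffAt ℝ (⊤ : ℕ∞) (fun y : R3 => (‖y‖ : ℂ)) x :=
    Complex.ofRealCLM.contDiff.contDiffAt.comp x (contDiffAt_norm ℝ hx)
  have h := (contDiffAt_const (c := Complex.I * lam)).mul norm |>.cexp.neg.mul
    (((contDiffAt_const (c := (4 * Real.pi : ℂ))).mul norm).inv (by simp [hx, hpi]))
  exact (h.congr_of_eventuallyEq
    (Eventually.of_forall fun y => div_eq_mul_inv _ _)).contDiffWithinAt

lemma fderiv_norm_apply {x : R3} (hx : x ≠ 0) (v : R3) :
    fderiv ℝ (fun y : R3 => ‖y‖) x v = inner ℝ x v / ‖x‖ := by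
  have hx' : ‖x‖ ≠ 0 := norm_ne_zero_iff.2 hx
  have diff := ((contDiffAt_norm ℝ hx (n := 1)).differentiableAt one_ne_zero).hasFDerivAt
  have h := DFunLike.congr_fun ((diff.pow 2).unique (hasFDerivAt_id x).norm_sq) v
  simp only [Nat.add_one_sub_one, pow_one, nsmul_eq_mul, Nat.cast_ofNat, smul_apply, smul_eq_mul,
    id_eq, ContinuousLinearMap.comp_id, coe_innerSL_apply] at h
  rw [eq_div_iff hx']
  linarith

lemma dirDeriv_theta {x : R3} (hx : x ≠ 0) (i : Fin 3) :
    dirDeriv (e i) (theta lam) x = -vecE lam x i := by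
  have hx' : (‖x‖ : ℂ) ≠ 0 := by simpa using hx
  have hpi : (Real.pi : ℂ) ≠ 0 := by exact_mod_cast Real.pi_ne_zero
  have id : HasDerivAt (fun r : ℝ => (r : ℂ)) 1 ‖x‖ := Complex.ofRealCLM.hasDerivAt
  have profile : HasDerivAt
      (fun r : ℝ => -Complex.exp (Complex.I * lam * r) / (4 * Real.pi * r))
      (radialFlux lam ‖x‖ * ((‖x‖ : ℂ) ^ 2)⁻¹) ‖x‖ := by
    refine ((id.const_mul (Complex.I * lam)).cexp.neg.div
      (id.const_mul (4 * Real.pi : ℂ)) (by simp [hx, hpi])).congr_deriv ?_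
    simp only [radialFlux, Pi.neg_apply]
    field_simp
    ring
  have h : fderiv ℝ (theta lam) x = _ := (profile.hasFDerivAt.comp x
    ((contDiffAt_norm ℝ hx (n := 1)).differentiableAt one_ne_zero).hasFDerivAt).fderiv
  calc dirDeriv (e i) (theta lam) x
      = ((x i / ‖x‖ : ℝ) : ℂ) * (radialFlux lam ‖x‖ * ((‖x‖ : ℂ) ^ 2)⁻¹) := by
        have coord : inner ℝ x (e i) = x i := by simp [EuclideanSpace.inner_single_right]
        simp [dirDeriv, h, fderiv_norm_apply hx, coord]
    _ = _ := by
        rw [vecE_eq_radialFlux]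
        push_cast
        field_simp

lemma contDiffOn_vecE (i : Fin 3) : ContDiffOn ℝ (⊤ : ℕ∞) (fun x => vecE lam x i) {0}ᶜ := by
  have h := (((contDiffOn_theta lam).fderiv_of_isOpen isOpen_compl_singleton
    (m := (⊤ : ℕ∞)) le_rfl).clm_apply (contDiffOn_const (c := e i))).neg
  exact h.congr fun x hx => by
    simpa [dirDeriv] using congrArg Neg.neg (dirDeriv_theta lam hx i).symm

lemma measurable_theta : Measurable (theta lam) := by unfold theta; fun_prop

lemma measurable_vecE (i : Fin 3) : Measurable fun x => vecE lam x i := by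
  have := measurable_theta lam
  unfold vecE
  fun_prop

lemma norm_theta (x : R3) :
    ‖theta lam x‖ = ‖Complex.exp (Complex.I * lam * ‖x‖)‖ / (4 * Real.pi) * ‖x‖⁻¹ := by
  simp only [theta, norm_div, norm_neg, norm_mul, Complex.norm_ofNat, Complex.norm_real,
    Real.norm_eq_abs, abs_of_pos Real.pi_pos, abs_norm]
  ring

lemma locallyIntegrable_theta : LocallyIntegrable (theta lam) :=
  locallyIntegrable_of_norm_le (k := 1)
    (g := fun x => ‖Complex.exp (Complex.I * lam * ‖x‖)‖ / (4 * Real.pi)) (by simp)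
    (measurable_theta lam).aestronglyMeasurable (by fun_prop) fun x => by rw [norm_theta, pow_one]

lemma locallyIntegrable_inv_norm_mul_theta :
    LocallyIntegrable fun x : R3 => (‖x‖ : ℂ)⁻¹ * theta lam x :=
  locallyIntegrable_of_norm_le (k := 2)
    (g := fun x => ‖Complex.exp (Complex.I * lam * ‖x‖)‖ / (4 * Real.pi)) (by simp)
    ((by fun_prop : Measurable fun x : R3 => (‖x‖ : ℂ)⁻¹).mul
      (measurable_theta lam)).aestronglyMeasurable (by fun_prop) fun x => by
      rw [norm_mul, norm_theta, norm_inv, Complex.norm_real, norm_norm, sq, mul_inv]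
      exact le_of_eq (by ring)

lemma locallyIntegrable_vecE (i : Fin 3) : LocallyIntegrable fun x => vecE lam x i := by
  have hflux : Continuous (radialFlux lam) := by unfold radialFlux; fun_prop
  refine locallyIntegrable_of_norm_le (k := 2) (g := fun x => ‖radialFlux lam ‖x‖‖) (by simp)
    (measurable_vecE lam i).aestronglyMeasurable (by fun_prop) fun x => ?_
  rw [vecE_eq_radialFlux, norm_neg, norm_mul, norm_mul, norm_inv, norm_pow, Complex.norm_real,
    Complex.norm_real, norm_norm, mul_assoc]
  gcongr
  calc (‖x‖ ^ 3)⁻¹ * ‖x i‖ ≤ (‖x‖ ^ 3)⁻¹ * ‖x‖ := by gcongr; exact PiLp.norm_apply_le x i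
    _ = (‖x‖ ^ 2)⁻¹ * (‖x‖⁻¹ * ‖x‖) := by ring
    _ ≤ (‖x‖ ^ 2)⁻¹ := mul_le_of_le_one_right (by positivity) inv_mul_le_one

lemma deriv_ofFun_theta (i : Fin 3) :
    Distr.deriv (e i) (Distr.ofFun Set.univ (theta lam))
      = Distr.ofFun Set.univ fun x => -vecE lam x i := by
  have ae_eq : dirDeriv (e i) (theta lam) =ᵐ[volume] fun x => -vecE lam x i := by
    filter_upwards [compl_mem_ae_iff.2 (measure_singleton (0 : R3))] with x hx
    exact dirDeriv_theta lam hx i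
  have loc : LocallyIntegrable (dirDeriv (e i) (theta lam)) :=
    (locallyIntegrable_vecE lam i).neg.congr ae_eq.symm
  rw [Distr.deriv_ofFun_of_contDiffOn_compl_zero ((contDiffOn_theta lam).of_le (by simp))
    (locallyIntegrable_theta lam) loc (locallyIntegrable_inv_norm_mul_theta lam)]
  exact Distr.ofFun_congr MeasurableSet.univ (loc.locallyIntegrableOn _)
    ((locallyIntegrable_vecE lam i).neg.locallyIntegrableOn _) (by simpa using ae_eq)

lemma toSphere_real_univ : (volume : Measure R3).toSphere.real Set.univ = 4 * Real.pi := by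
  rw [Measure.toSphere_real_apply_univ, Measure.real, EuclideanSpace.volume_ball_fin_three]
  rw [finrank_euclideanSpace_fin, ENNReal.ofReal_one, one_pow, one_mul,
    ENNReal.toReal_ofReal (by positivity)]
  push_cast
  ring

theorem sum_integral_dirDeriv_mul_vecE {φ : R3 → ℂ} (hφ : IsTest Set.univ φ) :
    ∑ i, ∫ x, dirDeriv (e i) φ x * vecE lam x i = φ 0 - lam ^ 2 * ∫ x, φ x * theta lam x := by
  rw [← integral_finsetSum _ fun i _ => (hφ.dirDeriv (e i)).integrable_mul
    ((locallyIntegrable_vecE lam i).locallyIntegrableOn _), ← integral_const_mul]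
  have radial := integral_radial_mul_fderiv (hasDerivAt_radialFlux lam) (by fun_prop) hφ
  have divergence_integrand (x : R3) : ∑ i, dirDeriv (e i) φ x * vecE lam x i
      = -(radialFlux lam ‖x‖ * ((‖x‖ : ℂ) ^ 3)⁻¹ * fderiv ℝ φ x x) := by
    have expand : fderiv ℝ φ x x = ∑ i, (x i : ℂ) * dirDeriv (e i) φ x := by
      nth_rewrite 2 [← sum_smul_e x]
      simp only [map_sum, map_smul, Complex.real_smul, dirDeriv]
    rw [expand, Finset.mul_sum, ← Finset.sum_neg_distrib]
    exact Finset.sum_congr rfl fun i _ => by rw [vecE_eq_radialFlux]; ring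
  have laplacian_integrand (x : R3) : lam ^ 2 * ‖x‖ * Complex.exp (Complex.I * lam * ‖x‖)
      / (4 * Real.pi) * ((‖x‖ : ℂ) ^ 2)⁻¹ * φ x = -(lam ^ 2 * (φ x * theta lam x)) := by
    rcases eq_or_ne x 0 with rfl | hx
    · simp [theta]
    · have hx' : (‖x‖ : ℂ) ≠ 0 := by simpa using hx
      simp only [theta]
      field_simp
  have flux_zero : (((4 * Real.pi : ℝ) : ℂ) * (radialFlux lam 0 * φ 0)) = φ 0 := by
    have hpi : (Real.pi : ℂ) ≠ 0 := by exact_mod_cast Real.pi_ne_zero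
    simp only [Complex.ofReal_mul, Complex.ofReal_ofNat, radialFlux, Complex.ofReal_zero, mul_zero,
      sub_zero, Complex.exp_zero, mul_one]
    field_simp
  simp only [finrank_euclideanSpace_fin, toSphere_real_univ, flux_zero, Nat.add_one_sub_one,
    laplacian_integrand, integral_neg] at radial
  simp only [divergence_integrand, integral_neg, radial]
  ring

end FundamentalSolution

/-! ### The Helmholtz operator and parametrices -/

section Parametrix

variable {U : Set R3}

/-- The Helmholtz operator `Δ + λ²` on functions. -/
def helmholtz (lam : ℂ) (φ : R3 → ℂ) : R3 → ℂ :=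
  ∑ i, dirDeriv (e i) (dirDeriv (e i) φ) + lam ^ 2 • φ

lemma IsTest.helmholtz {φ : R3 → ℂ} (hφ : IsTest U φ) (lam : ℂ) :
    IsTest U (helmholtz lam φ) :=
  (testFunctions U).add_mem
    ((testFunctions U).sum_mem fun i _ => (hφ.dirDeriv (e i)).dirDeriv (e i))
    ((testFunctions U).smul_mem _ hφ)

lemma helmholtz_comp_add_right (lam : ℂ) (φ : R3 → ℂ) (y : R3) :
    helmholtz lam (fun x => φ (x + y)) = fun x => helmholtz lam φ (x + y) := by
  simp only [helmholtz, dirDeriv_comp_add_right]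
  funext x
  simp

/-- The Helmholtz operator `Δ + λ²` on distributions. -/
def Distr.helmholtz (lam : ℂ) (T : Distr U) : Distr U :=
  ∑ i, Distr.deriv (e i) (Distr.deriv (e i) T) + lam ^ 2 • T

lemma Distr.helmholtz_apply (lam : ℂ) (T : Distr U) (φ : testFunctions U) :
    Distr.helmholtz lam T φ = T ⟨MaxwellWeak.helmholtz lam φ, φ.2.helmholtz lam⟩ := by
  have split : (⟨MaxwellWeak.helmholtz lam φ, φ.2.helmholtz lam⟩ : testFunctions U)
      = ∑ i, testDeriv U (e i) (testDeriv U (e i) φ) + lam ^ 2 • φ :=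
    Subtype.ext (by simp [MaxwellWeak.helmholtz, testDeriv])
  simp [split, Distr.helmholtz, LinearMap.sum_apply, Distr.deriv_apply]

lemma Distr.helmholtz_ofFun {f : R3 → ℂ} (hf : ContDiff ℝ (⊤ : ℕ∞) f) (lam : ℂ) :
    Distr.helmholtz lam (Distr.ofFun Set.univ f)
      = Distr.ofFun Set.univ (MaxwellWeak.helmholtz lam f) := by
  have loc {g : R3 → ℂ} (hg : ContDiff ℝ (⊤ : ℕ∞) g) : LocallyIntegrableOn g Set.univ :=
    hg.continuous.locallyIntegrable.locallyIntegrableOn _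
  have second (i : Fin 3) := contDiff_dirDeriv (contDiff_dirDeriv hf (e i)) (e i)
  have deriv_eq {g : R3 → ℂ} (hg : ContDiff ℝ (⊤ : ℕ∞) g) (i : Fin 3) :
      Distr.deriv (e i) (Distr.ofFun Set.univ g) = Distr.ofFun Set.univ (dirDeriv (e i) g) :=
    Distr.deriv_ofFun isOpen_univ (hg.of_le (by simp)).contDiffOn (e i)
  have laplacian_smooth : ContDiff ℝ (⊤ : ℕ∞) (∑ i, dirDeriv (e i) (dirDeriv (e i) f)) := by
    simpa only [← Finset.sum_apply] using ContDiff.sum fun i _ => second i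
  rw [MaxwellWeak.helmholtz, Distr.ofFun_add (loc laplacian_smooth) ((loc hf).smul _),
    Distr.ofFun_sum _ fun i => loc (second i), Distr.ofFun_smul (loc hf)]
  simp only [Distr.helmholtz, deriv_eq hf, deriv_eq (contDiff_dirDeriv hf _)]

lemma Distr.helmholtz_mul {η : R3 → ℂ} (hη : ContDiff ℝ (⊤ : ℕ∞) η) (lam : ℂ) (T : Distr U) :
    Distr.helmholtz lam (Distr.mul hη T) = Distr.mul hη (Distr.helmholtz lam T)
      + ∑ i, (Distr.mul (contDiff_dirDeriv (contDiff_dirDeriv hη (e i)) (e i)) T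
        + (2 : ℂ) • Distr.mul (contDiff_dirDeriv hη (e i)) (Distr.deriv (e i) T)) := by
  simp only [Distr.helmholtz, Distr.deriv_mul, map_add, map_sum, map_smul,
    Finset.sum_add_distrib, two_smul]
  abel

/-- The Dirac distribution `φ ↦ φ 0`. -/
def dirac : Distr (Set.univ : Set R3) where
  toFun φ := φ.1 0
  map_add' _ _ := rfl
  map_smul' _ _ := rfl

theorem helmholtz_ofFun_theta (lam : ℂ) :
    Distr.helmholtz lam (Distr.ofFun Set.univ (theta lam)) = dirac := by
  ext φ
  have gradient_part : ∑ i, Distr.deriv (e i) (Distr.deriv (e i) (Distr.ofFun Set.univ (theta lam)))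
      φ = ∑ i, ∫ x, dirDeriv (e i) φ.1 x * vecE lam x i :=
    Finset.sum_congr rfl fun i _ => by
      have hE : LocallyIntegrableOn (fun x => -vecE lam x i) Set.univ :=
        (locallyIntegrable_vecE lam i).neg.locallyIntegrableOn _
      rw [deriv_ofFun_theta, Distr.deriv_apply, Distr.ofFun_apply hE]
      simp [testDeriv, integral_neg]
  rw [Distr.helmholtz, LinearMap.add_apply, LinearMap.sum_apply, gradient_part,
    sum_integral_dirDeriv_mul_vecE lam φ.2, LinearMap.smul_apply,
    Distr.ofFun_apply ((locallyIntegrable_theta lam).locallyIntegrableOn _)]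
  simp [dirac]

lemma IsTest.mul_of_contDiffOn_compl_zero {η F : R3 → ℂ} (hη : IsTest U η)
    (h0 : η =ᶠ[𝓝 0] fun _ => 0) (hF : ContDiffOn ℝ (⊤ : ℕ∞) F {0}ᶜ) : IsTest U (η * F) where
  contDiff := contDiff_iff_contDiffAt.2 fun x => by
    rcases eq_or_ne x 0 with rfl | hx
    · refine (contDiffAt_const (c := (0 : ℂ))).congr_of_eventuallyEq ?_
      filter_upwards [h0] with y hy
      simp [hy]
    · exact hη.contDiff.contDiffAt.mul (hF.contDiffAt (isOpen_compl_singleton.mem_nhds hx))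
  hasCompactSupport := hη.hasCompactSupport.mul_right
  tsupport_subset := tsupport_mul_subset_left.trans hη.tsupport_subset

variable (lam : ℂ) (χ : ContDiffBump (0 : R3))

/-- A bump function, seen as a complex-valued function. -/
def cutoff (x : R3) : ℂ := χ x

lemma isTest_cutoff : IsTest Set.univ (cutoff χ) where
  contDiff := Complex.ofRealCLM.contDiff.comp χ.contDiff
  hasCompactSupport := χ.hasCompactSupport.comp_left (g := Complex.ofReal) rfl
  tsupport_subset := Set.subset_univ _

lemma cutoff_eventuallyEq_one_of_mem_ball {x : R3} (hx : x ∈ Metric.ball 0 χ.rIn) :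
    cutoff χ =ᶠ[𝓝 x] fun _ => 1 := by
  filter_upwards [χ.eventuallyEq_one_of_mem_ball hx] with y hy
  simp [cutoff, hy]

lemma cutoff_eventuallyEq_one : cutoff χ =ᶠ[𝓝 0] fun _ => 1 :=
  cutoff_eventuallyEq_one_of_mem_ball χ (Metric.mem_ball_self χ.rIn_pos)

lemma cutoff_zero : cutoff χ 0 = 1 := (cutoff_eventuallyEq_one χ).eq_of_nhds

/-- The compactly supported approximation `χθ` of the fundamental solution `θ` of `Δ + λ²`. -/
def parametrix : R3 → ℂ := cutoff χ * theta lam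

/-- The partial derivatives `∂ᵢ(χθ)`. -/
def parametrixGrad (i : Fin 3) : R3 → ℂ :=
  dirDeriv (e i) (cutoff χ) * theta lam + cutoff χ * fun x => -vecE lam x i

/-- The error `(Δ + λ²)(χθ) - δ = Δχ θ + 2 grad χ · grad θ`. -/
def parametrixError : R3 → ℂ :=
  ∑ i, (dirDeriv (e i) (dirDeriv (e i) (cutoff χ)) * theta lam
    + (2 : ℂ) • (dirDeriv (e i) (cutoff χ) * fun x => -vecE lam x i))

lemma parametrix_of_mem_ball {x : R3} (hx : x ∈ Metric.ball 0 χ.rIn) :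
    parametrix lam χ x = theta lam x := by
  simp [parametrix, (cutoff_eventuallyEq_one_of_mem_ball χ hx).eq_of_nhds]

lemma parametrixGrad_of_mem_ball {x : R3} (hx : x ∈ Metric.ball 0 χ.rIn) (i : Fin 3) :
    parametrixGrad lam χ i x = -vecE lam x i := by
  have cutoff_one := cutoff_eventuallyEq_one_of_mem_ball χ hx
  simp [parametrixGrad, cutoff_one.eq_of_nhds,
    (dirDeriv_eventuallyEq_zero cutoff_one (e i)).eq_of_nhds]

lemma parametrixError_of_mem_ball {x : R3} (hx : x ∈ Metric.ball 0 χ.rIn) :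
    parametrixError lam χ x = 0 := by
  have first_zero (i : Fin 3) :=
    dirDeriv_eventuallyEq_zero (cutoff_eventuallyEq_one_of_mem_ball χ hx) (e i)
  simp [parametrixError, fun i => (first_zero i).eq_of_nhds,
    fun i => (dirDeriv_eventuallyEq_zero (first_zero i) (e i)).eq_of_nhds]

lemma integrable_parametrix : Integrable (parametrix lam χ) :=
  (isTest_cutoff χ).integrable_mul ((locallyIntegrable_theta lam).locallyIntegrableOn _)

lemma integrable_parametrixGrad (i : Fin 3) : Integrable (parametrixGrad lam χ i) :=
  (((isTest_cutoff χ).dirDeriv (e i)).integrable_mul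
    ((locallyIntegrable_theta lam).locallyIntegrableOn _)).add
    ((isTest_cutoff χ).integrable_mul ((locallyIntegrable_vecE lam i).neg.locallyIntegrableOn _))

lemma isTest_parametrixError : IsTest Set.univ (parametrixError lam χ) := by
  have first_zero (i : Fin 3) := dirDeriv_eventuallyEq_zero (cutoff_eventuallyEq_one χ) (e i)
  refine (testFunctions Set.univ).sum_mem fun i _ => (testFunctions Set.univ).add_mem ?_
    ((testFunctions Set.univ).smul_mem _ ?_)
  · exact (((isTest_cutoff χ).dirDeriv _).dirDeriv _).mul_of_contDiffOn_compl_zero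
      (dirDeriv_eventuallyEq_zero (first_zero i) (e i)) (contDiffOn_theta lam)
  · exact ((isTest_cutoff χ).dirDeriv _).mul_of_contDiffOn_compl_zero (first_zero i)
      (contDiffOn_vecE lam i).neg

lemma parametrix_neg (x : R3) : parametrix lam χ (-x) = parametrix lam χ x := by
  simp [parametrix, cutoff, theta, χ.neg]

lemma hasCompactSupport_parametrix : HasCompactSupport (parametrix lam χ) :=
  (isTest_cutoff χ).hasCompactSupport.mul_right

lemma tsupport_parametrix_subset : tsupport (parametrix lam χ) ⊆ Metric.closedBall 0 χ.rOut :=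
  tsupport_mul_subset_left.trans <|
    (closure_mono fun x hx => by simpa [cutoff] using hx : tsupport (cutoff χ) ⊆ tsupport χ).trans
      χ.tsupport_eq.subset

lemma isTest_parametrix_sub (χ' : ContDiffBump (0 : R3)) :
    IsTest Set.univ (parametrix lam χ - parametrix lam χ') := by
  have h := ((testFunctions Set.univ).sub_mem (isTest_cutoff χ) (isTest_cutoff χ') :
    IsTest Set.univ _).mul_of_contDiffOn_compl_zero ?_ (contDiffOn_theta lam)
  · rwa [sub_mul] at h
  · filter_upwards [cutoff_eventuallyEq_one χ, cutoff_eventuallyEq_one χ'] with x hx hx'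
    simp [hx, hx']

lemma deriv_ofFun_parametrix (i : Fin 3) :
    Distr.deriv (e i) (Distr.ofFun Set.univ (parametrix lam χ))
      = Distr.ofFun Set.univ (parametrixGrad lam χ i) := by
  have hχ := (isTest_cutoff χ).contDiff
  have hθ := (locallyIntegrable_theta lam).locallyIntegrableOn Set.univ
  have hE : LocallyIntegrableOn (fun x => -vecE lam x i) Set.univ :=
    (locallyIntegrable_vecE lam i).neg.locallyIntegrableOn _
  rw [parametrix, ← Distr.mul_ofFun isOpen_univ hθ hχ, Distr.deriv_mul, deriv_ofFun_theta,
    Distr.mul_ofFun isOpen_univ hθ, Distr.mul_ofFun isOpen_univ hE, ← Distr.ofFun_add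
      (Distr.locallyIntegrableOn_mul isOpen_univ hθ (contDiff_dirDeriv hχ (e i)))
      (Distr.locallyIntegrableOn_mul isOpen_univ hE hχ)]
  rfl

theorem helmholtz_ofFun_parametrix :
    Distr.helmholtz lam (Distr.ofFun Set.univ (parametrix lam χ))
      = dirac + Distr.ofFun Set.univ (parametrixError lam χ) := by
  have hχ := (isTest_cutoff χ).contDiff
  have hθ := (locallyIntegrable_theta lam).locallyIntegrableOn Set.univ
  have hE (i : Fin 3) : LocallyIntegrableOn (fun x => -vecE lam x i) Set.univ :=
    (locallyIntegrable_vecE lam i).neg.locallyIntegrableOn _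
  have h1 (i : Fin 3) := Distr.locallyIntegrableOn_mul isOpen_univ hθ
    (contDiff_dirDeriv (contDiff_dirDeriv hχ (e i)) (e i))
  have h2 (i : Fin 3) := Distr.locallyIntegrableOn_mul isOpen_univ (hE i)
    (contDiff_dirDeriv hχ (e i))
  have cutoff_dirac : Distr.mul hχ dirac = dirac := by
    ext φ
    simp [Distr.mul_apply, testMul, dirac, cutoff_zero]
  rw [parametrix, ← Distr.mul_ofFun isOpen_univ hθ hχ, Distr.helmholtz_mul, helmholtz_ofFun_theta,
    cutoff_dirac, parametrixError, Distr.ofFun_sum _ fun i => (h1 i).add ((h2 i).smul (2 : ℂ))]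
  congr! 2 with i
  rw [Distr.ofFun_add (h1 i) ((h2 i).smul _), Distr.ofFun_smul (h2 i), deriv_ofFun_theta,
    Distr.mul_ofFun isOpen_univ hθ, Distr.mul_ofFun isOpen_univ (hE i)]

end Parametrix

/-! ### Weyl's lemma -/

section Weyl

variable {U Ω : Set R3} (lam : ℂ) (χ : ContDiffBump (0 : R3))

lemma integral_helmholtz_mul_parametrix {φ : R3 → ℂ} (hφ : IsTest Set.univ φ) :
    ∫ x, helmholtz lam φ x * parametrix lam χ x
      = φ 0 + ∫ x, φ x * parametrixError lam χ x := by
  have h := LinearMap.congr_fun (helmholtz_ofFun_parametrix lam χ) ⟨φ, hφ⟩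
  rwa [Distr.helmholtz_apply, LinearMap.add_apply,
    Distr.ofFun_apply ((integrable_parametrix lam χ).locallyIntegrable.locallyIntegrableOn _),
    Distr.ofFun_apply ((isTest_parametrixError lam χ).integrable.locallyIntegrable
      |>.locallyIntegrableOn _)] at h

theorem helmholtz_ofFun_parametrix_convolution {f : R3 → ℂ} (hf : Integrable f) :
    Distr.helmholtz lam (Distr.ofFun U (parametrix lam χ ⋆ f))
      = Distr.ofFun U f + Distr.ofFun U (parametrixError lam χ ⋆ f) := by
  have hN := integrable_parametrix lam χ
  have hk := (isTest_parametrixError lam χ).integrable (μ := volume)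
  have loc {K : R3 → ℂ} (hK : Integrable K) : LocallyIntegrableOn (K ⋆ f) U :=
    (hK.integrable_convolution _ hf).locallyIntegrable.locallyIntegrableOn _
  have hfU := hf.locallyIntegrable.locallyIntegrableOn U
  ext ⟨φ, hφ⟩
  have reflected_error : IsTest Set.univ ((fun z => parametrixError lam χ (-z)) ⋆ φ) :=
    (hφ.convolution hk.comp_neg.locallyIntegrable
      ((isTest_parametrixError lam χ).hasCompactSupport.comp_homeomorph (Homeomorph.neg R3))).mono
      (Set.subset_univ _)
  have translate (y : R3) : ∫ x, helmholtz lam φ (x + y) * parametrix lam χ x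
      = φ y + ((fun z => parametrixError lam χ (-z)) ⋆ φ) y := by
    simpa only [helmholtz_comp_add_right, zero_add, reflect_convolution_apply]
      using integral_helmholtz_mul_parametrix lam χ (hφ.comp_add_right y)
  rw [Distr.helmholtz_apply, LinearMap.add_apply, Distr.ofFun_apply (loc hN),
    Distr.ofFun_apply hfU, Distr.ofFun_apply (loc hk),
    integral_mul_convolution (hφ.helmholtz lam) hN hf,
    integral_mul_convolution_eq_reflect hφ hk hf, ← integral_add (hφ.integrable_mul hfU)
      (reflected_error.integrable_mul (hf.locallyIntegrable.locallyIntegrableOn _))]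
  congr with y
  rw [translate]
  ring

lemma helmholtz_parametrix_convolution_ae {φ : R3 → ℂ} (hφ : IsTest U φ) :
    helmholtz lam (parametrix lam χ ⋆ φ) =ᵐ[volume] φ + (parametrixError lam χ ⋆ φ) := by
  have hN := (integrable_parametrix lam χ).locallyIntegrable
  have hk := (isTest_parametrixError lam χ).integrable (μ := volume)
  have hφi := hφ.integrable (μ := volume)
  have smooth := contDiff_convolution_of_isTest hN hφ
  have left : LocallyIntegrableOn (helmholtz lam (parametrix lam χ ⋆ φ)) Set.univ :=
    ((hφ.convolution hN (hasCompactSupport_parametrix lam χ)).helmholtz lam).integrable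
      |>.locallyIntegrable.locallyIntegrableOn _
  have h1 := hφi.locallyIntegrable.locallyIntegrableOn Set.univ
  have h2 := (hk.integrable_convolution (ContinuousLinearMap.mul ℝ ℂ) hφi).locallyIntegrable
    |>.locallyIntegrableOn Set.univ
  have h := helmholtz_ofFun_parametrix_convolution lam χ (U := Set.univ) hφi
  rw [Distr.helmholtz_ofFun smooth, ← Distr.ofFun_add h1 h2] at h
  simpa using Distr.ae_eq_of_ofFun_eq isOpen_univ left (h1.add h2) h

lemma IsTest.parametrix_convolution {φ : R3 → ℂ} {x₀ : R3} {r : ℝ}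
    (hφ : IsTest (Metric.ball x₀ r) φ) :
    IsTest (Metric.closedBall x₀ (χ.rOut + r)) (parametrix lam χ ⋆ φ) := by
  refine (hφ.convolution (integrable_parametrix lam χ).locallyIntegrable
    (hasCompactSupport_parametrix lam χ)).mono ?_
  rintro _ ⟨y, hy, z, hz, rfl⟩
  have hy := mem_closedBall_zero_iff.1 (tsupport_parametrix_subset lam χ hy)
  rw [mem_ball_iff_norm] at hz
  rw [mem_closedBall_iff_norm, add_sub_assoc]
  exact (norm_add_le _ _).trans (add_le_add hy hz.le)

variable {lam} {f : R3 → ℂ}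

lemma integral_mul_eq_neg_integral_error_convolution (hf : LocallyIntegrableOn f Ω)
    (h : Distr.helmholtz lam (Distr.ofFun Ω f) = 0) {x₀ : R3} {r : ℝ}
    (hχ : Metric.closedBall x₀ (χ.rOut + r) ⊆ Ω) {φ : R3 → ℂ}
    (hφ : IsTest (Metric.ball x₀ r) φ) :
    ∫ x, φ x * f x = -∫ x, (parametrixError lam χ ⋆ φ) x *
      (Metric.closedBall x₀ (χ.rOut + r)).indicator f x := by
  set K := Metric.closedBall x₀ (χ.rOut + r)
  have hfK : LocallyIntegrableOn (K.indicator f) Set.univ :=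
    ((integrable_indicator_iff Metric.isClosed_closedBall.measurableSet).2
      (hf.integrableOn_compact_subset hχ
        (isCompact_closedBall _ _))).locallyIntegrable.locallyIntegrableOn _
  have test := hφ.parametrix_convolution lam χ
  have test_error : IsTest Set.univ (parametrixError lam χ ⋆ φ) :=
    (hφ.convolution (isTest_parametrixError lam χ).integrable.locallyIntegrable
      (isTest_parametrixError lam χ).hasCompactSupport).mono (Set.subset_univ _)
  have on_K {ψ : R3 → ℂ} (hψ : IsTest K ψ) (x : R3) : ψ x * f x = ψ x * K.indicator f x := by
    by_cases hx : x ∈ K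
    · rw [Set.indicator_of_mem hx]
    · simp [hψ.eq_zero hx]
  have ball_subset : Metric.ball x₀ r ⊆ K := Metric.ball_subset_closedBall.trans
    (Metric.closedBall_subset_closedBall (by simp [χ.rOut_pos.le]))
  have tested : ∫ x, helmholtz lam (parametrix lam χ ⋆ φ) x * f x = 0 := by
    rw [← Distr.ofFun_apply hf ⟨_, (test.helmholtz lam).mono hχ⟩]
    exact (Distr.helmholtz_apply lam _ ⟨_, test.mono hχ⟩).symm.trans (by rw [h]; rfl)
  simp only [eq_neg_iff_add_eq_zero, ← tested, on_K (hφ.mono ball_subset),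
    on_K (test.helmholtz lam)]
  rw [← integral_add ((hφ.mono (Set.subset_univ _)).integrable_mul hfK)
    (test_error.integrable_mul hfK)]
  refine integral_congr_ae ?_
  filter_upwards [helmholtz_parametrix_convolution_ae lam χ hφ] with x hx
  rw [hx, Pi.add_apply, add_mul]

lemma exists_contDiff_ae_eq_on_ball (hf : LocallyIntegrableOn f Ω)
    (h : Distr.helmholtz lam (Distr.ofFun Ω f) = 0) {x₀ : R3} {r : ℝ}
    (hχ : Metric.closedBall x₀ (χ.rOut + r) ⊆ Ω) :
    ∃ u : R3 → ℂ, ContDiff ℝ (⊤ : ℕ∞) u ∧ f =ᵐ[volume.restrict (Metric.ball x₀ r)] u := by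
  set K := Metric.closedBall x₀ (χ.rOut + r)
  set k := parametrixError lam χ
  have hk : IsTest Set.univ k := isTest_parametrixError lam χ
  have hki : Integrable k volume := hk.integrable
  have hfK : Integrable (K.indicator f) volume :=
    (integrable_indicator_iff Metric.isClosed_closedBall.measurableSet).2
      (hf.integrableOn_compact_subset hχ (isCompact_closedBall _ _))
  have smooth : ContDiff ℝ (⊤ : ℕ∞) (-((fun z => k (-z)) ⋆ K.indicator f)) :=
    ((hk.hasCompactSupport.comp_homeomorph (Homeomorph.neg R3)).contDiff_convolution_left _
      (hk.contDiff.comp contDiff_neg) hfK.locallyIntegrable).neg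
  have ball_subset : Metric.ball x₀ r ⊆ K := Metric.ball_subset_closedBall.trans
    (Metric.closedBall_subset_closedBall (by simp [χ.rOut_pos.le]))
  have hf_ball := hf.mono_set (ball_subset.trans hχ)
  have smooth_loc : LocallyIntegrableOn _ (Metric.ball x₀ r) volume :=
    smooth.continuous.locallyIntegrable.locallyIntegrableOn _
  refine ⟨_, smooth, Distr.ae_eq_of_ofFun_eq Metric.isOpen_ball hf_ball smooth_loc ?_⟩
  ext ⟨φ, hφ⟩
  have reflected := integral_mul_convolution_eq_reflect hφ hki.comp_neg hfK
  simp only [neg_neg] at reflected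
  rw [Distr.ofFun_apply hf_ball, Distr.ofFun_apply smooth_loc,
    integral_mul_eq_neg_integral_error_convolution χ hf h hχ hφ]
  simp only [Pi.neg_apply, mul_neg, integral_neg, reflected, k, K]

end Weyl

section Gluing

variable {E F : Type*} [NormedAddCommGroup E] [NormedSpace ℝ E] [MeasurableSpace E] [BorelSpace E]
  [SecondCountableTopology E] [NormedAddCommGroup F] [NormedSpace ℝ F] {μ : Measure E}
  [μ.IsOpenPosMeasure] {Ω : Set E} {w : E → F}

theorem exists_contDiffOn_ae_eq_of_locally {n : WithTop ℕ∞} (hΩ : IsOpen Ω)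
    (h : ∀ x ∈ Ω, ∃ U, IsOpen U ∧ x ∈ U ∧ ∃ u, ContDiff ℝ n u ∧ w =ᵐ[μ.restrict U] u) :
    ∃ u, ContDiffOn ℝ n u Ω ∧ w =ᵐ[μ.restrict Ω] u := by
  choose! U U_open mem_U v v_smooth w_eq using h
  have agree {x y : E} (hx : x ∈ Ω) (hy : y ∈ Ω) (hyx : y ∈ U x) : v y y = v x y := by
    have w_eq_x := ae_restrict_of_ae_restrict_of_subset (Set.inter_subset_left (t := U y))
      (w_eq x hx)
    have w_eq_y := ae_restrict_of_ae_restrict_of_subset (Set.inter_subset_right (s := U x))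
      (w_eq y hy)
    exact Measure.eqOn_open_of_ae_eq (EventuallyEq.trans (EventuallyEq.symm w_eq_y) w_eq_x)
      ((U_open x hx).inter (U_open y hy)) (v_smooth y hy).continuous.continuousOn
      (v_smooth x hx).continuous.continuousOn ⟨hyx, mem_U y hy⟩
  refine ⟨fun x => v x x, fun x hx => ?_, ?_⟩
  · refine ((v_smooth x hx).contDiffAt.congr_of_eventuallyEq ?_).contDiffWithinAt
    filter_upwards [hΩ.mem_nhds hx, (U_open x hx).mem_nhds (mem_U x hx)] with y hy hyx
    exact agree hx hy hyx
  · rw [EventuallyEq, ae_restrict_iff' hΩ.measurableSet, ae_iff]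
    refine measure_null_of_locally_null _ fun x hx => ?_
    have hxΩ : x ∈ Ω := by_contra fun hx' => hx fun h => absurd h hx'
    refine ⟨_, inter_mem_nhdsWithin _ ((U_open x hxΩ).mem_nhds (mem_U x hxΩ)), ?_⟩
    have null := w_eq x hxΩ
    rw [EventuallyEq, ae_restrict_iff' (U_open x hxΩ).measurableSet, ae_iff] at null
    refine measure_mono_null ?_ null
    rintro y ⟨hy, hyx⟩ hy'
    exact hy fun hyΩ => (hy' hyx).trans (agree hxΩ hyΩ hyx).symm

end Gluing

theorem exists_contDiffOn_ae_eq_of_helmholtz_eq_zero {lam : ℂ} {Ω : Set R3}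
    {f : R3 → ℂ} (hΩ : IsOpen Ω) (hf : LocallyIntegrableOn f Ω)
    (h : Distr.helmholtz lam (Distr.ofFun Ω f) = 0) :
    ∃ u : R3 → ℂ, ContDiffOn ℝ (⊤ : ℕ∞) u Ω ∧ f =ᵐ[volume.restrict Ω] u := by
  refine exists_contDiffOn_ae_eq_of_locally hΩ fun x hx => ?_
  obtain ⟨s, hs, ball_subset⟩ := Metric.nhds_basis_closedBall.mem_iff.1 (hΩ.mem_nhds hx)
  let χ : ContDiffBump (0 : R3) := ⟨s / 4, s / 2, by positivity, by linarith⟩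
  exact ⟨Metric.ball x (s / 2), Metric.isOpen_ball, Metric.mem_ball_self (by positivity),
    exists_contDiff_ae_eq_on_ball χ hf h (by simpa only [χ, add_halves] using ball_subset)⟩

/-! ### Exhaustion of open sets and patching -/

section Exhaustion

variable {E : Type*} [NormedAddCommGroup E]

/-- The points of `Ω` at distance more than `δ` from the complement of `Ω`. As `δ` decreases to
`0`, these open sets exhaust `Ω`. -/
def innerSet (Ω : Set E) (δ : ℝ) : Set E := (Metric.cthickening δ Ωᶜ)ᶜ

lemma isOpen_innerSet (Ω : Set E) (δ : ℝ) : IsOpen (innerSet Ω δ) :=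
  Metric.isClosed_cthickening.isOpen_compl

lemma innerSet_subset (Ω : Set E) (δ : ℝ) : innerSet Ω δ ⊆ Ω :=
  Set.compl_subset_comm.1 (Metric.self_subset_cthickening Ωᶜ)

lemma innerSet_anti (Ω : Set E) : Antitone (innerSet Ω) := fun _ _ h =>
  Set.compl_subset_compl.2 (Metric.cthickening_mono h Ωᶜ)

open scoped Pointwise in
lemma closedBall_add_innerSet_subset (Ω : Set E) (δ : ℝ) :
    Metric.closedBall 0 δ + innerSet Ω δ ⊆ Ω := by
  rintro _ ⟨y, hy, x, hx, rfl⟩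
  by_contra h
  refine hx (Metric.mem_cthickening_of_dist_le x (y + x) δ Ωᶜ h ?_)
  simpa [dist_eq_norm] using hy

lemma exists_subset_innerSet {Ω K : Set E} (hΩ : IsOpen Ω) (hK : IsCompact K) (hKΩ : K ⊆ Ω) :
    ∃ n : ℕ, K ⊆ innerSet Ω (1 / (n + 1)) := by
  obtain ⟨δ, hδ, disj⟩ :=
    (Set.disjoint_compl_right_iff_subset.2 hKΩ).exists_cthickenings hK hΩ.isClosed_compl
  obtain ⟨n, hn⟩ := exists_nat_one_div_lt hδ
  exact ⟨n, ((Metric.self_subset_cthickening K).trans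
    (Set.subset_compl_iff_disjoint_right.2 disj)).trans (innerSet_anti Ω hn.le)⟩

lemma exists_ae_eq_restrict_of_monotone {X Y : Type*} [MeasurableSpace X] {μ : Measure X}
    [Nonempty Y] {U : ℕ → Set X} (hU : ∀ n, MeasurableSet (U n)) (F : ℕ → X → Y)
    (hF : ∀ m n, m ≤ n → F m =ᵐ[μ.restrict (U m)] F n) :
    ∃ f : X → Y, ∀ n, f =ᵐ[μ.restrict (U n)] F n := by
  classical
  refine ⟨fun x => if h : ∃ n, x ∈ U n then F (Nat.find h) x else Classical.arbitrary Y,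
    fun n => ?_⟩
  have consistent : ∀ᵐ x ∂μ, ∀ m, m ≤ n → x ∈ U m → F m x = F n x := by
    simp only [ae_all_iff]
    exact fun m hm => (ae_restrict_iff' (hU m)).1 (hF m n hm)
  rw [EventuallyEq, ae_restrict_iff' (hU n)]
  filter_upwards [consistent] with x hx hxn
  have hex : ∃ n, x ∈ U n := ⟨n, hxn⟩
  rw [dif_pos hex]
  exact hx _ (Nat.find_min' hex hxn) (Nat.find_spec hex)

lemma locallyIntegrableOn_of_memLp_isCompact {X F : Type*} [TopologicalSpace X] [T2Space X]
    [LocallyCompactSpace X] [MeasurableSpace X] [OpensMeasurableSpace X]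
    {μ : Measure X} [IsFiniteMeasureOnCompacts μ] [NormedAddCommGroup F] {f : X → F} {p : ℝ≥0∞}
    {U : Set X} (hp : 1 ≤ p) (hU : IsOpen U)
    (hf : ∀ K ⊆ U, IsCompact K → MemLp f p (μ.restrict K)) : LocallyIntegrableOn f U μ :=
  (locallyIntegrableOn_iff hU.isLocallyClosed).2 fun K hKU hK =>
    haveI : IsFiniteMeasure (μ.restrict K) := ⟨by simpa using hK.measure_lt_top⟩
    (hf K hKU hK).integrable hp

end Exhaustion

section Restriction

variable {E : Type*} [NormedAddCommGroup E] [NormedSpace ℝ E] {U V Ω : Set E}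

/-- The restriction of a distribution to a smaller set. -/
def Distr.restrict (hUV : U ⊆ V) : Distr V →ₗ[ℂ] Distr U :=
  (Submodule.inclusion fun _ (hφ : IsTest U _) => hφ.mono hUV).dualMap

lemma Distr.restrict_deriv (hUV : U ⊆ V) (v : E) (T : Distr V) :
    Distr.restrict hUV (Distr.deriv v T) = Distr.deriv v (Distr.restrict hUV T) := rfl

lemma Distr.eq_of_restrict_innerSet_eq {T S : Distr Ω} (hΩ : IsOpen Ω)
    (h : ∀ n : ℕ, Distr.restrict (innerSet_subset Ω (1 / (n + 1))) T
      = Distr.restrict (innerSet_subset Ω (1 / (n + 1))) S) : T = S := by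
  ext ⟨φ, hφ⟩
  obtain ⟨n, hn⟩ := exists_subset_innerSet hΩ hφ.hasCompactSupport hφ.tsupport_subset
  exact LinearMap.congr_fun (h n) ⟨φ, hφ.contDiff, hφ.hasCompactSupport, hn⟩

variable [MeasureSpace E] [BorelSpace E]

lemma Distr.restrict_ofFun (hUV : U ⊆ V) {f : E → ℂ} (hf : LocallyIntegrableOn f V) :
    Distr.restrict hUV (Distr.ofFun V f) = Distr.ofFun U f := by
  ext φ
  exact (Distr.ofFun_apply hf _).trans (Distr.ofFun_apply (hf.mono_set hUV) φ).symm

lemma Distr.exists_memLp_isCompact_of_restrict_innerSet [FiniteDimensional ℝ E]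
    [(volume : Measure E).IsAddHaarMeasure] {p : ℝ≥0∞} (hp : 1 ≤ p) (hΩ : IsOpen Ω)
    {T : Distr Ω} (h : ∀ n : ℕ, ∃ F : E → ℂ, MemLp F p ∧
      Distr.restrict (innerSet_subset Ω (1 / (n + 1))) T = Distr.ofFun _ F) :
    ∃ f : E → ℂ, (∀ K ⊆ Ω, IsCompact K → MemLp f p (volume.restrict K)) ∧
      T = Distr.ofFun Ω f := by
  choose F hF hTF using h
  have loc (n : ℕ) (U : Set E) : LocallyIntegrableOn (F n) U :=
    ((hF n).locallyIntegrable hp).locallyIntegrableOn U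
  have consistent (m n : ℕ) (hmn : m ≤ n) :
      F m =ᵐ[volume.restrict (innerSet Ω (1 / (m + 1)))] F n :=
    Distr.ae_eq_of_ofFun_eq (isOpen_innerSet Ω _) (loc m _) (loc n _) <| by
      rw [← hTF m, ← Distr.restrict_ofFun (innerSet_anti Ω (Nat.one_div_le_one_div hmn)) (loc n _),
        ← hTF n]
      rfl
  obtain ⟨f, hf⟩ := exists_ae_eq_restrict_of_monotone
    (fun n => (isOpen_innerSet Ω _).measurableSet) F consistent
  have memLp_f (K : Set E) (hKΩ : K ⊆ Ω) (hK : IsCompact K) : MemLp f p (volume.restrict K) := by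
    obtain ⟨n, hn⟩ := exists_subset_innerSet hΩ hK hKΩ
    exact ((hF n).restrict K).ae_eq
      (EventuallyEq.symm (ae_restrict_of_ae_restrict_of_subset hn (hf n)))
  have loc_f := locallyIntegrableOn_of_memLp_isCompact hp hΩ memLp_f
  refine ⟨f, memLp_f, Distr.eq_of_restrict_innerSet_eq hΩ fun n => ?_⟩
  rw [hTF, Distr.restrict_ofFun _ loc_f]
  exact Distr.ofFun_congr (isOpen_innerSet Ω _).measurableSet (loc n _)
    (loc_f.mono_set (innerSet_subset Ω _)) (hf n).symm

end Restriction

/-! ### The gradient of the divergence of a volume potential -/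

section GradDiv

lemma Distr.ofFun_add_convolution {E : Type*} [NormedAddCommGroup E] [NormedSpace ℝ E]
    [MeasureSpace E] [BorelSpace E] [FiniteDimensional ℝ E] [(volume : Measure E).IsAddHaarMeasure]
    {M N f : E → ℂ} {U : Set E} (hU : MeasurableSet U) (hM : Integrable M) (hN : Integrable N)
    (hf : Integrable f) :
    Distr.ofFun U ((M + N) ⋆ f) = Distr.ofFun U (M ⋆ f) + Distr.ofFun U (N ⋆ f) := by
  have loc {K : E → ℂ} (hK : Integrable K) : LocallyIntegrableOn (K ⋆ f) U :=
    (hK.integrable_convolution _ hf).locallyIntegrable.locallyIntegrableOn U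
  rw [← Distr.ofFun_add (loc hM) (loc hN)]
  refine Distr.ofFun_congr hU (loc (hM.add hN)) ((loc hM).add (loc hN)) (ae_restrict_of_ae ?_)
  filter_upwards [hM.ae_convolution_exists (ContinuousLinearMap.mul ℝ ℂ) hf,
    hN.ae_convolution_exists (ContinuousLinearMap.mul ℝ ℂ) hf] with x hMx hNx
  exact hMx.add_distrib hNx

open scoped Pointwise in
lemma Distr.sum_deriv_ofFun_convolution {E ι : Type*} [NormedAddCommGroup E] [NormedSpace ℝ E]
    [MeasureSpace E] [BorelSpace E] [FiniteDimensional ℝ E] [(volume : Measure E).IsAddHaarMeasure]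
    [Fintype ι] {v : ι → E} {N d : E → ℂ} {j : ι → E → ℂ} {U Ω : Set E} (hN : Integrable N)
    (hc : HasCompactSupport N) (hU : tsupport (fun z => N (-z)) + U ⊆ Ω)
    (hj : ∀ l, Integrable (j l)) (hd : Integrable d)
    (hdiv : ∑ l, Distr.deriv (v l) (Distr.ofFun Ω (j l)) = Distr.ofFun Ω d) :
    ∑ l, Distr.deriv (v l) (Distr.ofFun U (N ⋆ j l)) = Distr.ofFun U (N ⋆ d) := by
  have loc {f : E → ℂ} (hf : Integrable f) (W : Set E) : LocallyIntegrableOn f W :=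
    hf.locallyIntegrable.locallyIntegrableOn W
  have loc_conv {f : E → ℂ} (hf : Integrable f) : LocallyIntegrableOn (N ⋆ f) U :=
    loc (hN.integrable_convolution _ hf) U
  have hN' : LocallyIntegrable fun z => N (-z) := hN.comp_neg.locallyIntegrable
  ext ⟨φ, hφ⟩
  have hψ : IsTest Ω ((fun z => N (-z)) ⋆ φ) :=
    (hφ.convolution hN' (hc.comp_homeomorph (Homeomorph.neg E))).mono hU
  have transfer (l : ι) : Distr.deriv (v l) (Distr.ofFun U (N ⋆ j l)) ⟨φ, hφ⟩
      = Distr.deriv (v l) (Distr.ofFun Ω (j l)) ⟨_, hψ⟩ := by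
    rw [Distr.deriv_apply, Distr.deriv_apply, Distr.ofFun_apply (loc_conv (hj l)),
      Distr.ofFun_apply (loc (hj l) Ω)]
    simp only [testDeriv, LinearMap.coe_mk, AddHom.coe_mk, dirDeriv_convolution hN' hφ]
    rw [integral_mul_convolution_eq_reflect (hφ.dirDeriv (v l)) hN (hj l)]
  rw [LinearMap.sum_apply, Finset.sum_congr rfl fun l _ => transfer l, ← LinearMap.sum_apply, hdiv,
    Distr.ofFun_apply (loc hd Ω), Distr.ofFun_apply (loc_conv hd),
    integral_mul_convolution_eq_reflect hφ hN hd]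

variable {lam : ℂ} {χ : ContDiffBump (0 : R3)} {p : ℝ≥0∞} {Ω : Set R3} {j : Fin 3 → R3 → ℂ}
  {d : R3 → ℂ}

lemma Distr.deriv_ofFun_isTest_convolution {U : Set R3} {s f : R3 → ℂ} (hs : IsTest Set.univ s)
    (hf : Integrable f) (v : R3) :
    Distr.deriv v (Distr.ofFun U (s ⋆ f)) = Distr.ofFun U (dirDeriv v s ⋆ f) :=
  Distr.deriv_ofFun_convolution hs.integrable (hs.dirDeriv v).integrable
    (Distr.deriv_ofFun isOpen_univ (hs.contDiff.of_le (by simp)).contDiffOn v) hf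

theorem exists_grad_div_innerSet (hp : 1 ≤ p) (hj : ∀ l, Integrable (j l))
    (hjp : ∀ l, MemLp (j l) p) (hd : Integrable d) (hdp : MemLp d p)
    (hdiv : ∑ l, Distr.deriv (e l) (Distr.ofFun Ω (j l)) = Distr.ofFun Ω d) {δ : ℝ} (hδ : 0 < δ)
    (i : Fin 3) :
    ∃ F : R3 → ℂ, MemLp F p ∧ Distr.deriv (e i) (∑ l, Distr.deriv (e l)
      (Distr.ofFun (innerSet Ω δ) (parametrix lam χ ⋆ j l))) = Distr.ofFun (innerSet Ω δ) F := by
  let χ' : ContDiffBump (0 : R3) := ⟨δ / 2, δ, by positivity, by linarith⟩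
  set M := parametrix lam χ'
  set s := parametrix lam χ - M
  have hM : Integrable M := integrable_parametrix lam χ'
  have hDM := integrable_parametrixGrad lam χ' i
  have hs : IsTest Set.univ s := isTest_parametrix_sub lam χ χ'
  have hs2 (l : Fin 3) : Integrable (dirDeriv (e i) (dirDeriv (e l) s)) :=
    ((hs.dirDeriv (e l)).dirDeriv (e i)).integrable
  have loc {f : R3 → ℂ} (hf : Integrable f) : LocallyIntegrableOn f (innerSet Ω δ) :=
    hf.locallyIntegrable.locallyIntegrableOn _
  have split (l : Fin 3) : Distr.ofFun (innerSet Ω δ) (parametrix lam χ ⋆ j l)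
      = Distr.ofFun (innerSet Ω δ) (M ⋆ j l) + Distr.ofFun (innerSet Ω δ) (s ⋆ j l) := by
    rw [← Distr.ofFun_add_convolution (isOpen_innerSet Ω δ).measurableSet hM hs.integrable (hj l),
      add_sub_cancel]
  have near : ∑ l, Distr.deriv (e l) (Distr.ofFun (innerSet Ω δ) (M ⋆ j l))
      = Distr.ofFun (innerSet Ω δ) (M ⋆ d) := by
    refine Distr.sum_deriv_ofFun_convolution hM (hasCompactSupport_parametrix lam χ') ?_ hj hd hdiv
    simp only [M, parametrix_neg]
    exact (Set.add_subset_add_right (tsupport_parametrix_subset lam χ')).trans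
      (closedBall_add_innerSet_subset Ω δ)
  refine ⟨(parametrixGrad lam χ' i ⋆ d) + ∑ l, (dirDeriv (e i) (dirDeriv (e l) s) ⋆ j l),
    (memLp_convolution hp hDM hdp).add
      (memLp_finsetSum' _ fun l _ => memLp_convolution hp (hs2 l) (hjp l)), ?_⟩
  rw [Distr.ofFun_add (loc (hDM.integrable_convolution _ hd)) (loc (integrable_finsetSum' _
      fun l _ => (hs2 l).integrable_convolution _ (hj l))),
    Distr.ofFun_sum _ fun l => loc ((hs2 l).integrable_convolution _ (hj l)),
    ← Distr.deriv_ofFun_convolution hM hDM (deriv_ofFun_parametrix lam χ' i) hd, ← near]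
  simp only [split, map_add, Finset.sum_add_distrib, map_sum,
    Distr.deriv_ofFun_isTest_convolution hs (hj _),
    Distr.deriv_ofFun_isTest_convolution (hs.dirDeriv _) (hj _)]

theorem exists_grad_div (hp : 1 ≤ p) (hΩ : IsOpen Ω) (hj : ∀ l, Integrable (j l))
    (hjp : ∀ l, MemLp (j l) p) (hd : Integrable d) (hdp : MemLp d p)
    (hdiv : ∑ l, Distr.deriv (e l) (Distr.ofFun Ω (j l)) = Distr.ofFun Ω d) (i : Fin 3) :
    ∃ B : R3 → ℂ, (∀ K ⊆ Ω, IsCompact K → MemLp B p (volume.restrict K)) ∧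
      Distr.deriv (e i) (∑ l, Distr.deriv (e l) (Distr.ofFun Ω (parametrix lam χ ⋆ j l)))
        = Distr.ofFun Ω B := by
  refine Distr.exists_memLp_isCompact_of_restrict_innerSet hp hΩ fun n => ?_
  obtain ⟨F, hF, h⟩ := exists_grad_div_innerSet (lam := lam) (χ := χ) hp hj hjp hd hdp hdiv
    (Nat.one_div_pos_of_nat (n := n)) i
  refine ⟨F, hF, h ▸ ?_⟩
  simp only [Distr.restrict_deriv, map_sum]
  refine Finset.sum_congr rfl fun l _ => ?_
  rw [Distr.restrict_ofFun _ (((integrable_parametrix lam χ).integrable_convolution _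
    (hj l)).locallyIntegrable.locallyIntegrableOn Ω)]

end GradDiv

/-! ### Vector calculus for distributions -/

section VectorCalculus

lemma locallyIntegrableOn_eval {U : Set R3} {F : R3 → C3} (hF : LocallyIntegrableOn F U)
    (i : Fin 3) : LocallyIntegrableOn (fun x => F x i) U := fun x hx =>
  let ⟨s, hs, h⟩ := hF x hx
  ⟨s, hs, h.eval i⟩

/-- Fields whose components are distributions on an open subset of Euclidean three-space. -/
abbrev VectorDistr (U : Set R3) := Fin 3 → Distr U

namespace VectorDistr

variable {U : Set R3}

/-- The gradient of a distribution. -/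
def grad : Distr U →ₗ[ℂ] VectorDistr U := LinearMap.pi fun i => Distr.deriv (e i)

/-- The divergence of a field of distributions. -/
def div : VectorDistr U →ₗ[ℂ] Distr U := ∑ i, Distr.deriv (e i) ∘ₗ LinearMap.proj i

/-- The curl of a field of distributions. -/
def curl : VectorDistr U →ₗ[ℂ] VectorDistr U where
  toFun T := ![Distr.deriv (e 1) (T 2) - Distr.deriv (e 2) (T 1),
    Distr.deriv (e 2) (T 0) - Distr.deriv (e 0) (T 2),
    Distr.deriv (e 0) (T 1) - Distr.deriv (e 1) (T 0)]
  map_add' T S := by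
    funext i
    fin_cases i <;> simp <;> abel
  map_smul' c T := by
    funext i
    fin_cases i <;> simp [smul_sub]

lemma grad_apply (T : Distr U) (i : Fin 3) : grad T i = Distr.deriv (e i) T := rfl

lemma div_apply (T : VectorDistr U) : div T = ∑ i, Distr.deriv (e i) (T i) := by
  simp [div]

lemma curl_apply (T : VectorDistr U) :
    curl T = ![Distr.deriv (e 1) (T 2) - Distr.deriv (e 2) (T 1),
      Distr.deriv (e 2) (T 0) - Distr.deriv (e 0) (T 2),
      Distr.deriv (e 0) (T 1) - Distr.deriv (e 1) (T 0)] := rfl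

lemma curl_grad (T : Distr U) : curl (grad T) = 0 := by
  funext i
  fin_cases i <;> simp [curl_apply, grad_apply, Distr.deriv_comm]

lemma div_curl (T : VectorDistr U) : div (curl T) = 0 := by
  simp only [div_apply, curl_apply, Fin.sum_univ_three, Matrix.cons_val, map_sub]
  rw [Distr.deriv_comm (e 1) (e 0), Distr.deriv_comm (e 2) (e 0), Distr.deriv_comm (e 2) (e 1)]
  abel

lemma curl_curl (lam : ℂ) (T : VectorDistr U) :
    curl (curl T) = grad (div T) + lam ^ 2 • T - fun i => Distr.helmholtz lam (T i) := by
  funext i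
  fin_cases i <;>
  · simp only [curl_apply, div_apply, grad_apply, Distr.helmholtz, Fin.sum_univ_three,
      Matrix.cons_val, map_sub, map_add, Pi.add_apply, Pi.sub_apply, Pi.smul_apply, Fin.isValue,
      Fin.zero_eta, Fin.mk_one, Fin.reduceFinMk]
    simp only [Distr.deriv_comm (e 1) (e 0), Distr.deriv_comm (e 2) (e 0),
      Distr.deriv_comm (e 2) (e 1)]
    abel

lemma div_eq_zero_of_curl_eq_smul {κ : ℂ} (hκ : κ ≠ 0) {T : VectorDistr U}
    (h : curl T = κ • T) : div T = 0 := by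
  have := div_curl T
  rwa [h, map_smul, smul_eq_zero_iff_right hκ] at this

lemma helmholtz_eq_zero_of_curl_eq_smul {κ : ℂ} (hκ : κ ≠ 0) {T : VectorDistr U}
    (h : curl T = κ • T) (i : Fin 3) : Distr.helmholtz κ (T i) = 0 := by
  have := curl_curl κ T
  rw [div_eq_zero_of_curl_eq_smul hκ h, map_zero, zero_add, h, map_smul, h, smul_smul, ← sq,
    eq_comm, sub_eq_self] at this
  exact congrFun this i

lemma curl_source_sub_curl {lam κ : ℂ} (hκ : κ ^ 2 = lam ^ 2) {A J : VectorDistr U}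
    (h : ∀ i, Distr.helmholtz lam (A i) = J i) :
    curl (J - curl (κ • A - curl A)) = κ • curl (κ • A - curl A) := by
  have source_eq : J = grad (div A) + lam ^ 2 • A - curl (curl A) := by
    rw [curl_curl lam A, funext h, sub_sub_cancel]
  rw [source_eq]
  simp only [map_sub, map_add, map_smul, curl_grad, ← hκ]
  module

/-- The field of distributions defined by a field of locally integrable functions. -/
def ofField (U : Set R3) (F : R3 → C3) : VectorDistr U := fun i => Distr.ofFun U fun x => F x i

variable {F G : R3 → C3}

lemma ofField_add (hF : LocallyIntegrableOn F U) (hG : LocallyIntegrableOn G U) :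
    ofField U (F + G) = ofField U F + ofField U G :=
  funext fun i => Distr.ofFun_add (locallyIntegrableOn_eval hF i) (locallyIntegrableOn_eval hG i)

lemma ofField_smul (hF : LocallyIntegrableOn F U) (c : ℂ) :
    ofField U (c • F) = c • ofField U F :=
  funext fun i => Distr.ofFun_smul (locallyIntegrableOn_eval hF i) c

lemma ofField_sub (hF : LocallyIntegrableOn F U) (hG : LocallyIntegrableOn G U) :
    ofField U (F - G) = ofField U F - ofField U G :=
  funext fun i => Distr.ofFun_sub (locallyIntegrableOn_eval hF i) (locallyIntegrableOn_eval hG i)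

lemma ofField_eq_iff (hU : IsOpen U) (hF : LocallyIntegrableOn F U)
    (hG : LocallyIntegrableOn G U) : ofField U F = ofField U G ↔ F =ᵐ[volume.restrict U] G := by
  refine ⟨fun h => ?_, fun h => funext fun i => Distr.ofFun_congr hU.measurableSet
    (locallyIntegrableOn_eval hF i) (locallyIntegrableOn_eval hG i) (h.fun_comp (· i))⟩
  have components (i : Fin 3) := Distr.ae_eq_of_ofFun_eq hU (locallyIntegrableOn_eval hF i)
    (locallyIntegrableOn_eval hG i) (congrFun h i)
  filter_upwards [ae_all_iff.2 components] with x hx using funext hx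

end VectorDistr

end VectorCalculus

open VectorDistr (ofField)

/-! ### Weak curls and divergences -/

section ForceFree

variable {Ω : Set R3} {F G : R3 → C3}

lemma mem_smoothTests_iff {φ : R3 → ℂ} {ψ : R3 → C3} :
    (φ, ψ) ∈ smoothTests Ω ↔ IsTest Ω φ ∧ ψ = grad φ :=
  ⟨fun ⟨h, hc, hs, ht⟩ => ⟨⟨h, hc, hs⟩, ht⟩, fun ⟨⟨h, hc, hs⟩, ht⟩ => ⟨h, hc, hs, ht⟩⟩

lemma weakDiv_smoothTests_iff {d : R3 → ℂ} (hF : LocallyIntegrableOn F Ω)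
    (hd : LocallyIntegrableOn d Ω) :
    WeakDiv (smoothTests Ω) Ω F d ↔ VectorDistr.div (ofField Ω F) = Distr.ofFun Ω d := by
  have pairing {φ : R3 → ℂ} (hφ : IsTest Ω φ) :
      -∫ x in Ω, grad φ x ⬝ᵥ F x = VectorDistr.div (ofField Ω F) ⟨φ, hφ⟩ := by
    have integrable (i : Fin 3) : IntegrableOn (fun x => grad φ x i * F x i) Ω :=
      ((hφ.dirDeriv (e i)).integrable_mul (locallyIntegrableOn_eval hF i)).integrableOn
    simp only [dotProduct, integral_finsetSum _ fun i _ => integrable i]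
    rw [VectorDistr.div_apply, LinearMap.sum_apply, ← Finset.sum_neg_distrib]
    refine Finset.sum_congr rfl fun i _ => ?_
    rw [Distr.deriv_apply, ofField, Distr.ofFun_apply (locallyIntegrableOn_eval hF i)]
    exact congrArg _ ((hφ.dirDeriv (e i)).setIntegral_mul _)
  constructor
  · intro h
    ext ⟨φ, hφ⟩
    rw [← pairing hφ, Distr.ofFun_apply hd, ← hφ.setIntegral_mul]
    exact (h (φ, grad φ) (mem_smoothTests_iff.2 ⟨hφ, rfl⟩)).symm
  · rintro h ⟨φ, ψ⟩ ht
    obtain ⟨hφ, rfl⟩ := mem_smoothTests_iff.1 ht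
    rw [pairing hφ, h, Distr.ofFun_apply hd]
    exact hφ.setIntegral_mul d

lemma integral_grad_crossProduct (hF : LocallyIntegrableOn F Ω) {φ : R3 → ℂ}
    (hφ : IsTest Ω φ) (i : Fin 3) :
    -(∫ x in Ω, crossProduct (grad φ x) (F x)) i
      = VectorDistr.curl (ofField Ω F) i ⟨φ, hφ⟩ := by
  have integrable (a b : Fin 3) : IntegrableOn (fun x => grad φ x a * F x b) Ω :=
    ((hφ.dirDeriv (e a)).integrable_mul (locallyIntegrableOn_eval hF b)).integrableOn
  have component (a b : Fin 3) :
      ∫ x in Ω, (grad φ x a * F x b - grad φ x b * F x a)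
        = (Distr.deriv (e b) (ofField Ω F a) - Distr.deriv (e a) (ofField Ω F b)) ⟨φ, hφ⟩ := by
    have pairing (a b : Fin 3) : ∫ x in Ω, grad φ x a * F x b
        = ofField Ω F b (testDeriv Ω (e a) ⟨φ, hφ⟩) := by
      rw [ofField, Distr.ofFun_apply (locallyIntegrableOn_eval hF b)]
      exact (hφ.dirDeriv (e a)).setIntegral_mul _
    rw [integral_sub (integrable a b) (integrable b a), pairing, pairing, LinearMap.sub_apply,
      Distr.deriv_apply, Distr.deriv_apply]
    ring
  have integrable_cross : ∀ i, IntegrableOn (fun x => crossProduct (grad φ x) (F x) i) Ω := by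
    intro i
    fin_cases i <;> exact (integrable _ _).sub (integrable _ _)
  rw [eval_integral integrable_cross]
  fin_cases i
  all_goals
    refine (congrArg _ (component _ _)).trans ?_
    rw [← LinearMap.neg_apply, neg_sub]
    rfl

lemma weakCurl_smoothTests_iff (hF : LocallyIntegrableOn F Ω) (hG : LocallyIntegrableOn G Ω) :
    WeakCurl (smoothTests Ω) Ω F G ↔ VectorDistr.curl (ofField Ω F) = ofField Ω G := by
  have pairing {φ : R3 → ℂ} (hφ : IsTest Ω φ) (i : Fin 3) :
      (∫ x in Ω, φ x • G x) i = ofField Ω G i ⟨φ, hφ⟩ := by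
    have integrable (i : Fin 3) : IntegrableOn (fun x => (φ x • G x) i) Ω :=
      (hφ.integrable_mul (locallyIntegrableOn_eval hG i)).integrableOn
    rw [eval_integral integrable, ofField, Distr.ofFun_apply (locallyIntegrableOn_eval hG i)]
    exact hφ.setIntegral_mul _
  constructor
  · intro h
    ext i ⟨φ, hφ⟩
    rw [← integral_grad_crossProduct hF hφ, ← pairing hφ]
    exact congrFun (h (φ, grad φ) (mem_smoothTests_iff.2 ⟨hφ, rfl⟩)).symm i
  · rintro h ⟨φ, ψ⟩ ht
    obtain ⟨hφ, rfl⟩ := mem_smoothTests_iff.1 ht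
    ext i
    rw [pairing hφ, ← h, ← integral_grad_crossProduct hF hφ]
    rfl

/-! ### Force-free fields -/

variable {u : R3 → C3}

lemma partialDeriv_eq_dirDeriv {x : R3} (hu : DifferentiableAt ℝ u x) (i k : Fin 3) :
    partialDeriv u i k x = dirDeriv (e i) (fun y => u y k) x := by
  rw [partialDeriv, dirDeriv, fderiv_pi (differentiableAt_pi.1 hu)]
  rfl

lemma continuousOn_partialDeriv (hΩ : IsOpen Ω) (hu : ContDiffOn ℝ 1 u Ω) (i k : Fin 3) :
    ContinuousOn (partialDeriv u i k) Ω :=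
  continuousOn_pi.1 ((hu.continuousOn_fderiv_of_isOpen hΩ le_rfl).clm_apply continuousOn_const) k

lemma continuousOn_divergence (hΩ : IsOpen Ω) (hu : ContDiffOn ℝ 1 u Ω) :
    ContinuousOn (divergence u) Ω :=
  continuousOn_finsetSum _ fun i _ => continuousOn_partialDeriv hΩ hu i i

lemma continuousOn_curl (hΩ : IsOpen Ω) (hu : ContDiffOn ℝ 1 u Ω) : ContinuousOn (curl u) Ω := by
  have h := continuousOn_partialDeriv hΩ hu
  refine continuousOn_pi.2 fun i => ?_
  fin_cases i
  exacts [(h 1 2).sub (h 2 1), (h 2 0).sub (h 0 2), (h 0 1).sub (h 1 0)]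

lemma deriv_ofField (hΩ : IsOpen Ω) (hu : ContDiffOn ℝ 1 u Ω) (i k : Fin 3) :
    Distr.deriv (e i) (ofField Ω u k) = Distr.ofFun Ω (partialDeriv u i k) := by
  have huk := contDiffOn_pi.1 hu k
  refine (Distr.deriv_ofFun hΩ huk (e i)).trans (Distr.ofFun_congr hΩ.measurableSet
    ((continuousOn_dirDeriv huk hΩ _).locallyIntegrableOn hΩ.measurableSet)
    ((continuousOn_partialDeriv hΩ hu i k).locallyIntegrableOn hΩ.measurableSet)
    (ae_restrict_of_forall_mem hΩ.measurableSet fun x hx => ?_))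
  exact (partialDeriv_eq_dirDeriv
    ((hu.differentiableOn one_ne_zero).differentiableAt (hΩ.mem_nhds hx)) i k).symm

lemma div_ofField (hΩ : IsOpen Ω) (hu : ContDiffOn ℝ 1 u Ω) :
    VectorDistr.div (ofField Ω u) = Distr.ofFun Ω (divergence u) := by
  have loc (i : Fin 3) := (continuousOn_partialDeriv hΩ hu i i).locallyIntegrableOn (μ := volume)
    hΩ.measurableSet
  have sum_eq : divergence u = ∑ i, partialDeriv u i i := by
    funext x
    simp [divergence]
  rw [VectorDistr.div_apply, sum_eq, Distr.ofFun_sum _ loc]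
  simp only [deriv_ofField hΩ hu]

lemma curl_ofField (hΩ : IsOpen Ω) (hu : ContDiffOn ℝ 1 u Ω) :
    VectorDistr.curl (ofField Ω u) = ofField Ω (curl u) := by
  have loc (i k : Fin 3) := (continuousOn_partialDeriv hΩ hu i k).locallyIntegrableOn (μ := volume)
    hΩ.measurableSet
  funext i
  simp only [VectorDistr.curl_apply, deriv_ofField hΩ hu]
  fin_cases i <;> exact (Distr.ofFun_sub (loc _ _) (loc _ _)).symm

lemma isForceFree_iff (hΩ : IsOpen Ω) (hu : ContDiffOn ℝ 1 u Ω) {κ : ℂ} (hκ : κ ≠ 0) :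
    IsForceFree Ω κ u ↔ VectorDistr.curl (ofField Ω u) = -κ • ofField Ω u := by
  have hu_loc : LocallyIntegrableOn u Ω := hu.continuousOn.locallyIntegrableOn hΩ.measurableSet
  have weak_curl_iff : VectorDistr.curl (ofField Ω u) = -κ • ofField Ω u ↔
      Set.EqOn (curl u) (-κ • u) Ω := by
    have curl_cont := continuousOn_curl hΩ hu
    rw [curl_ofField hΩ hu, ← VectorDistr.ofField_smul hu_loc, VectorDistr.ofField_eq_iff hΩ
      (curl_cont.locallyIntegrableOn hΩ.measurableSet) (hu_loc.smul _)]
    exact ⟨fun h => Measure.eqOn_open_of_ae_eq h hΩ curl_cont (hu.continuousOn.const_smul _),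
      fun h => ae_restrict_of_forall_mem hΩ.measurableSet h⟩
  rw [weak_curl_iff]
  refine ⟨fun h x hx => by simpa using eq_neg_of_add_eq_zero_left (h.curl_eq x hx),
    fun h => ⟨hu, ?_, fun x hx => by simp [h hx]⟩⟩
  have div_cont := continuousOn_divergence hΩ hu
  have div_loc := div_cont.locallyIntegrableOn (μ := volume) hΩ.measurableSet
  have div_eq := VectorDistr.div_eq_zero_of_curl_eq_smul (neg_ne_zero.2 hκ) (weak_curl_iff.2 h)
  rw [div_ofField hΩ hu, ← zero_smul ℂ, ← Distr.ofFun_smul div_loc] at div_eq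
  have div_ae := Distr.ae_eq_of_ofFun_eq hΩ div_loc (div_loc.smul _) div_eq
  exact fun x hx => by
    simpa using Measure.eqOn_open_of_ae_eq div_ae hΩ div_cont (div_cont.const_smul 0) hx

theorem exists_isForceFree_ae_eq_iff (hΩ : IsOpen Ω) (hF : LocallyIntegrableOn F Ω) {κ : ℂ}
    (hκ : κ ≠ 0) : (∃ u, IsForceFree Ω κ u ∧ F =ᵐ[volume.restrict Ω] u) ↔
      VectorDistr.curl (ofField Ω F) = -κ • ofField Ω F := by
  have transfer {u : R3 → C3} (hu : ContDiffOn ℝ 1 u Ω) (h : F =ᵐ[volume.restrict Ω] u) :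
      ofField Ω F = ofField Ω u :=
    (VectorDistr.ofField_eq_iff hΩ hF
      (hu.continuousOn.locallyIntegrableOn hΩ.measurableSet)).2 h
  constructor
  · rintro ⟨u, hu, h⟩
    rw [transfer hu.contDiffOn h]
    exact (isForceFree_iff hΩ hu.contDiffOn hκ).1 hu
  · intro h
    choose v v_smooth hv using fun i => exists_contDiffOn_ae_eq_of_helmholtz_eq_zero hΩ
      (locallyIntegrableOn_eval hF i)
      (VectorDistr.helmholtz_eq_zero_of_curl_eq_smul (neg_ne_zero.2 hκ) h i)
    have u_smooth : ContDiffOn ℝ 1 (fun x i => v i x) Ω :=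
      contDiffOn_pi.2 fun i => (v_smooth i).of_le (by simp)
    have ae_eq : F =ᵐ[volume.restrict Ω] fun x i => v i x := by
      filter_upwards [ae_all_iff.2 hv] with x hx using funext hx
    exact ⟨_, (isForceFree_iff hΩ u_smooth hκ).2 (transfer u_smooth ae_eq ▸ h), ae_eq⟩

end ForceFree

/-! ### The Teodorescu component operators -/

section Teodorescu

variable (lam : ℂ) (χ : ContDiffBump (0 : R3))

/-- The volume potential of the source `J`, for a parametrix instead of the fundamental
solution. -/
def volumePotential (J : R3 → C3) (x : R3) : C3 :=
  fun k => (parametrix lam χ ⋆ fun y => J y k) x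

/-- The curl of the volume potential. -/
def curlPotential (J : R3 → C3) (x : R3) : C3 :=
  ![(parametrixGrad lam χ 1 ⋆ fun y => J y 2) x - (parametrixGrad lam χ 2 ⋆ fun y => J y 1) x,
    (parametrixGrad lam χ 2 ⋆ fun y => J y 0) x - (parametrixGrad lam χ 0 ⋆ fun y => J y 2) x,
    (parametrixGrad lam χ 0 ⋆ fun y => J y 1) x - (parametrixGrad lam χ 1 ⋆ fun y => J y 0) x]

variable {J : R3 → C3} {Ω : Set R3} {p : ℝ≥0∞}

lemma memLp_volumePotential (hp : 1 ≤ p) (hJ : MemLp J p) :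
    MemLp (volumePotential lam χ J) p :=
  MemLp.of_eval fun k => memLp_convolution hp (integrable_parametrix lam χ) (hJ.eval k)

lemma memLp_curlPotential (hp : 1 ≤ p) (hJ : MemLp J p) : MemLp (curlPotential lam χ J) p := by
  have h (i k : Fin 3) := memLp_convolution hp (integrable_parametrixGrad lam χ i) (hJ.eval k)
  refine MemLp.of_eval fun k => ?_
  fin_cases k
  exacts [(h 1 2).sub (h 2 1), (h 2 0).sub (h 0 2), (h 0 1).sub (h 1 0)]

lemma curl_ofField_volumePotential (hJ : Integrable J) :
    VectorDistr.curl (ofField Ω (volumePotential lam χ J))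
      = ofField Ω (curlPotential lam χ J) := by
  have loc (i k : Fin 3) : LocallyIntegrableOn (parametrixGrad lam χ i ⋆ fun y => J y k) Ω :=
    ((integrable_parametrixGrad lam χ i).integrable_convolution _ (hJ.eval k)
      ).locallyIntegrable.locallyIntegrableOn _
  have deriv (i k : Fin 3) : Distr.deriv (e i) (ofField Ω (volumePotential lam χ J) k)
      = Distr.ofFun Ω (parametrixGrad lam χ i ⋆ fun y => J y k) :=
    Distr.deriv_ofFun_convolution (integrable_parametrix lam χ)
      (integrable_parametrixGrad lam χ i) (deriv_ofFun_parametrix lam χ i) (hJ.eval k)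
  funext i
  simp only [VectorDistr.curl_apply, deriv]
  fin_cases i <;> exact (Distr.ofFun_sub (loc _ _) (loc _ _)).symm

variable {χ}

lemma helmholtz_ofField_volumePotential (hJ : Integrable J) (hJΩ : ∀ x ∉ Ω, J x = 0)
    (hχ : ∀ x ∈ Ω, ∀ y ∈ Ω, x - y ∈ Metric.ball 0 χ.rIn) (i : Fin 3) :
    Distr.helmholtz lam (ofField Ω (volumePotential lam χ J) i) = ofField Ω J i := by
  have error_zero : Distr.ofFun Ω (parametrixError lam χ ⋆ fun y => J y i) = 0 := by
    have loc : LocallyIntegrableOn (parametrixError lam χ ⋆ fun y => J y i) Ω :=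
      ((isTest_parametrixError lam χ).integrable.integrable_convolution _ (hJ.eval i)
        ).locallyIntegrable.locallyIntegrableOn _
    ext φ
    rw [Distr.ofFun_apply loc, LinearMap.zero_apply, ← φ.2.setIntegral_mul]
    refine setIntegral_eq_zero_of_forall_eq_zero fun x hx => ?_
    rw [convolution_apply, integral_eq_zero_of_ae (ae_of_all _ fun y => ?_), mul_zero]
    by_cases hy : y ∈ Ω
    · simp [parametrixError_of_mem_ball lam χ (hχ x hx y hy)]
    · simp [hJΩ y hy]
  exact (helmholtz_ofFun_parametrix_convolution lam χ (hJ.eval i)).trans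
    (by rw [error_zero, add_zero, ofField])

lemma integrable_and_integral_parametrix_smul {x : R3}
    (h : ∀ k, Integrable fun y => parametrix lam χ (x - y) * J y k) :
    Integrable (fun y => parametrix lam χ (x - y) • J y) ∧
      ∫ y, parametrix lam χ (x - y) • J y = volumePotential lam χ J x := by
  refine ⟨Integrable.of_eval h, funext fun k => ?_⟩
  rw [eval_integral (f := fun y => parametrix lam χ (x - y) • J y) h, volumePotential,
    convolution_apply]
  rfl

lemma integrable_and_integral_parametrixGrad_cross {x : R3}
    (h : ∀ i k, Integrable fun y => parametrixGrad lam χ i (x - y) * J y k) :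
    Integrable (fun y => crossProduct (fun i => parametrixGrad lam χ i (x - y)) (J y)) ∧
      ∫ y, crossProduct (fun i => parametrixGrad lam χ i (x - y)) (J y)
        = curlPotential lam χ J x := by
  have components (k : Fin 3) :
      Integrable fun y => crossProduct (fun i => parametrixGrad lam χ i (x - y)) (J y) k := by
    fin_cases k
    exacts [(h 1 2).sub (h 2 1), (h 2 0).sub (h 0 2), (h 0 1).sub (h 1 0)]
  refine ⟨Integrable.of_eval components, funext fun k => ?_⟩
  rw [eval_integral components]
  simp only [curlPotential, convolution_apply]
  fin_cases k <;> exact integral_sub (h _ _) (h _ _)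

lemma indicator_teodorescuIntegrand (j : R3 → C3) (κ : ℂ) {x : R3}
    (hχ : ∀ y ∈ Ω, x - y ∈ Metric.ball 0 χ.rIn) :
    Ω.indicator (teodorescuIntegrand lam κ j x) = fun y =>
      κ • parametrix lam χ (x - y) • Ω.indicator j y
        - crossProduct (fun i => parametrixGrad lam χ i (x - y)) (Ω.indicator j y) := by
  funext y
  by_cases hy : y ∈ Ω
  · have grad_eq : (fun i => parametrixGrad lam χ i (x - y)) = -vecE lam (x - y) :=
      funext (parametrixGrad_of_mem_ball lam χ (hχ y hy))
    rw [grad_eq, parametrix_of_mem_ball lam χ (hχ y hy), Set.indicator_of_mem hy,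
      Set.indicator_of_mem hy, teodorescuIntegrand, map_neg, LinearMap.neg_apply, sub_neg_eq_add,
      mul_smul]
  · simp [hy]

theorem teodorescuTwo_ae_eq (hΩ : MeasurableSet Ω) {j : R3 → C3} (hj : IntegrableOn j Ω)
    (hχ : ∀ x ∈ Ω, ∀ y ∈ Ω, x - y ∈ Metric.ball 0 χ.rIn) (κ : ℂ) :
    ∀ᵐ x ∂volume.restrict Ω, IntegrableOn (teodorescuIntegrand lam κ j x) Ω ∧
      teodorescuTwo Ω lam κ j x
        = κ • volumePotential lam χ (Ω.indicator j) x - curlPotential lam χ (Ω.indicator j) x := by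
  set J := Ω.indicator j
  have hJ : Integrable J := (integrable_indicator_iff hΩ).2 hj
  have ae_integrable {N : R3 → ℂ} (hN : Integrable N) (k : Fin 3) :
      ∀ᵐ x, Integrable fun y => N (x - y) * J y k := by
    filter_upwards [hN.ae_convolution_exists (ContinuousLinearMap.mul ℝ ℂ) (hJ.eval k)] with x hx
    exact hx.integrable_swap
  have ae_N := ae_all_iff.2 (ae_integrable (integrable_parametrix lam χ))
  have ae_DN := ae_all_iff.2 fun i => ae_all_iff.2
    (ae_integrable (integrable_parametrixGrad lam χ i))
  rw [ae_restrict_iff' hΩ]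
  filter_upwards [ae_N, ae_DN] with x hN hDN hx
  obtain ⟨N_int, N_eq⟩ := integrable_and_integral_parametrix_smul lam hN
  obtain ⟨DN_int, DN_eq⟩ := integrable_and_integral_parametrixGrad_cross lam hDN
  have indicator_eq := indicator_teodorescuIntegrand lam j κ (hχ x hx)
  refine ⟨(integrable_indicator_iff hΩ).1 (indicator_eq ▸ (N_int.smul κ).sub DN_int), ?_⟩
  rw [teodorescuTwo, ← integral_indicator hΩ, indicator_eq,
    integral_sub (f := fun y => κ • parametrix lam χ (x - y) • J y) (N_int.smul κ) DN_int,
    integral_smul, N_eq, DN_eq]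

lemma exists_contDiffBump_sub_mem_ball (hb : Bornology.IsBounded Ω) :
    ∃ χ : ContDiffBump (0 : R3), ∀ x ∈ Ω, ∀ y ∈ Ω, x - y ∈ Metric.ball 0 χ.rIn := by
  obtain ⟨R, hR, hΩR⟩ := hb.exists_pos_norm_le
  refine ⟨⟨3 * R, 4 * R, by positivity, by linarith⟩, fun x hx y hy => ?_⟩
  rw [mem_ball_zero_iff]
  calc ‖x - y‖ ≤ ‖x‖ + ‖y‖ := norm_sub_le x y
    _ < 3 * R := by linarith [hΩR x hx, hΩR y hy]

variable {lam}

lemma MemLpLoc.locallyIntegrableOn {F : R3 → C3} (hF : MemLpLoc F p Ω) (hp : 1 ≤ p)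
    (hΩ : IsOpen Ω) : LocallyIntegrableOn F Ω :=
  locallyIntegrableOn_of_memLp_isCompact hp hΩ hF

lemma ofField_indicator (hΩ : IsOpen Ω) (hJ : IntegrableOn J Ω) :
    ofField Ω (Ω.indicator J) = ofField Ω J :=
  (VectorDistr.ofField_eq_iff hΩ
    (((integrable_indicator_iff hΩ.measurableSet).2 hJ).locallyIntegrable.locallyIntegrableOn Ω)
    hJ.locallyIntegrableOn).2 (indicator_ae_eq_restrict hΩ.measurableSet)

lemma exists_grad_div_volumePotential [IsFiniteMeasure (volume.restrict Ω)] (hp : 1 ≤ p)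
    (hΩ : IsOpen Ω) {j : R3 → C3} {divj : R3 → ℂ} (hj : MemWDiv Ω p j divj) :
    ∃ B, MemLpLoc B p Ω ∧
      VectorDistr.grad (VectorDistr.div (ofField Ω (volumePotential lam χ (Ω.indicator j))))
        = ofField Ω B := by
  obtain ⟨hjp, hdp, hdiv⟩ := hj
  have hj_int : IntegrableOn j Ω := hjp.integrable hp
  have hd_int : IntegrableOn divj Ω := hdp.integrable hp
  have hJ : Integrable (Ω.indicator j) := (integrable_indicator_iff hΩ.measurableSet).2 hj_int
  have hD : Integrable (Ω.indicator divj) :=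
    (integrable_indicator_iff hΩ.measurableSet).2 hd_int
  have weak_div : ∑ l, Distr.deriv (e l) (Distr.ofFun Ω fun y => Ω.indicator j y l)
      = Distr.ofFun Ω (Ω.indicator divj) := by
    rw [Distr.ofFun_congr hΩ.measurableSet (hD.locallyIntegrable.locallyIntegrableOn Ω)
      hd_int.locallyIntegrableOn (indicator_ae_eq_restrict hΩ.measurableSet),
      ← (weakDiv_smoothTests_iff hj_int.locallyIntegrableOn hd_int.locallyIntegrableOn).1 hdiv,
      ← ofField_indicator hΩ hj_int, VectorDistr.div_apply]
    rfl
  have hJp : MemLp (Ω.indicator j) p := (memLp_indicator_iff_restrict hΩ.measurableSet).2 hjp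
  choose B hB grad_div using fun i => exists_grad_div (lam := lam) (χ := χ) hp hΩ
    (fun l => hJ.eval l) (fun l => hJp.eval l) hD
    ((memLp_indicator_iff_restrict hΩ.measurableSet).2 hdp) weak_div i
  refine ⟨fun x i => B i x, fun K hK hKc => MemLp.of_eval fun i => hB i K hK hKc,
    funext fun i => ?_⟩
  rw [VectorDistr.grad_apply, VectorDistr.div_apply]
  exact grad_div i

lemma memLpLoc_and_ofField_teodorescuTwo [IsFiniteMeasure (volume.restrict Ω)] (hp : 1 ≤ p)
    (hΩ : IsOpen Ω) (hχ : ∀ x ∈ Ω, ∀ y ∈ Ω, x - y ∈ Metric.ball 0 χ.rIn)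
    (hJ : MemLp J p (volume.restrict Ω)) (κ : ℂ) :
    MemLpLoc (teodorescuTwo Ω lam κ J) p Ω ∧ ofField Ω (teodorescuTwo Ω lam κ J)
      = κ • ofField Ω (volumePotential lam χ (Ω.indicator J))
        - ofField Ω (curlPotential lam χ (Ω.indicator J)) := by
  have hJp : MemLp (Ω.indicator J) p := (memLp_indicator_iff_restrict hΩ.measurableSet).2 hJ
  have hA := memLp_volumePotential lam χ hp hJp
  have hC := memLp_curlPotential lam χ hp hJp
  have A_loc := (hA.locallyIntegrable hp).locallyIntegrableOn Ω
  have C_loc := (hC.locallyIntegrable hp).locallyIntegrableOn Ω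
  have T_eq := (teodorescuTwo_ae_eq lam hΩ.measurableSet (hJ.integrable hp) hχ κ).mono
    fun _ h => h.2
  have T_mem : MemLpLoc (teodorescuTwo Ω lam κ J) p Ω := fun K hK _ =>
    (((hA.const_smul κ).sub hC).restrict K).ae_eq
      (ae_restrict_of_ae_restrict_of_subset hK (EventuallyEq.symm T_eq))
  refine ⟨T_mem, ?_⟩
  rw [(VectorDistr.ofField_eq_iff hΩ (T_mem.locallyIntegrableOn hp hΩ)
    ((A_loc.smul κ).sub C_loc)).2 T_eq, VectorDistr.ofField_sub (A_loc.smul κ) C_loc,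
    VectorDistr.ofField_smul A_loc]

theorem exists_curl_teodorescuTwo (hp : 1 ≤ p) (hΩ : IsOpen Ω) (hb : Bornology.IsBounded Ω)
    {j : R3 → C3} {divj : R3 → ℂ} (hj : MemWDiv Ω p j divj) :
    ∃ S : ℂ → R3 → C3, ∀ κ, κ ^ 2 = lam ^ 2 →
      (∀ᵐ x ∂volume.restrict Ω, IntegrableOn (teodorescuIntegrand lam κ j x) Ω) ∧
      MemLpLoc (teodorescuTwo Ω lam κ j) p Ω ∧ MemLpLoc (S κ) p Ω ∧
      VectorDistr.curl (ofField Ω (teodorescuTwo Ω lam κ j)) = ofField Ω (S κ) ∧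
      VectorDistr.curl (ofField Ω j - ofField Ω (S κ)) = κ • ofField Ω (S κ) := by
  have finite : IsFiniteMeasure (volume.restrict Ω) := ⟨by simpa using hb.measure_lt_top⟩
  obtain ⟨χ, hχ⟩ := exists_contDiffBump_sub_mem_ball hb
  have hj_int : IntegrableOn j Ω := hj.1.integrable hp
  have hJ : Integrable (Ω.indicator j) := (integrable_indicator_iff hΩ.measurableSet).2 hj_int
  have hJp : MemLp (Ω.indicator j) p := (memLp_indicator_iff_restrict hΩ.measurableSet).2 hj.1
  obtain ⟨B, hB, grad_div⟩ := exists_grad_div_volumePotential (lam := lam) (χ := χ) hp hΩ hj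
  set A := volumePotential lam χ (Ω.indicator j)
  set C := curlPotential lam χ (Ω.indicator j)
  have hA : MemLp A p := memLp_volumePotential lam χ hp hJp
  have hC : MemLp C p := memLp_curlPotential lam χ hp hJp
  have A_loc := (hA.locallyIntegrable hp).locallyIntegrableOn Ω
  have B_loc := hB.locallyIntegrableOn hp hΩ
  have C_loc := (hC.locallyIntegrable hp).locallyIntegrableOn Ω
  have helmholtz_A := helmholtz_ofField_volumePotential lam hJ
    (fun x hx => Set.indicator_of_notMem hx j) hχ
  rw [ofField_indicator hΩ hj_int] at helmholtz_A
  have curl_A : VectorDistr.curl (ofField Ω A) = ofField Ω C :=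
    curl_ofField_volumePotential lam χ hJ
  refine ⟨fun κ => κ • C - (B + lam ^ 2 • A - j), fun κ hκ => ?_⟩
  obtain ⟨T_mem, T_eq⟩ := memLpLoc_and_ofField_teodorescuTwo hp hΩ hχ hj.1 κ
  have curl_T : VectorDistr.curl (ofField Ω (teodorescuTwo Ω lam κ j))
      = ofField Ω (κ • C - (B + lam ^ 2 • A - j)) := by
    have j_loc := hj_int.locallyIntegrableOn
    have D_loc := (B_loc.add (A_loc.smul (lam ^ 2))).sub j_loc
    rw [T_eq, ← curl_A, map_sub, map_smul, VectorDistr.curl_curl lam, grad_div,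
      funext helmholtz_A, curl_A, VectorDistr.ofField_sub (C_loc.smul κ) D_loc,
      VectorDistr.ofField_sub (B_loc.add (A_loc.smul _)) j_loc,
      VectorDistr.ofField_add B_loc (A_loc.smul _), VectorDistr.ofField_smul C_loc,
      VectorDistr.ofField_smul A_loc]
  refine ⟨(teodorescuTwo_ae_eq lam hΩ.measurableSet hj_int hχ κ).mono fun _ h => h.1, T_mem,
    fun K hK hKc => ?_, curl_T, ?_⟩
  · exact ((hC.restrict K).const_smul κ).sub (((hB K hK hKc).add
      ((hA.restrict K).const_smul _)).sub (hj.1.mono_measure (Measure.restrict_mono hK le_rfl)))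
  · rw [← curl_T, T_eq, ← curl_A]
    exact VectorDistr.curl_source_sub_curl hκ helmholtz_A

end Teodorescu

/-! ### Test functions in the Sobolev space -/

section Sobolev

lemma tendsto_integral_bilin {X 𝕜 A B C : Type*} [MeasurableSpace X] {μ : Measure X}
    [NontriviallyNormedField 𝕜] [NormedAddCommGroup A] [NormedSpace 𝕜 A] [NormedAddCommGroup B]
    [NormedSpace 𝕜 B] [NormedAddCommGroup C] [NormedSpace 𝕜 C] [NormedSpace ℝ C]
    {p q : ℝ≥0∞} [ENNReal.HolderTriple q p 1] (L : A →L[𝕜] B →L[𝕜] C) {f : ℕ → X → A}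
    {f₀ : X → A} {g : X → B} (hf : ∀ n, MemLp (f n) q μ) (hf₀ : MemLp f₀ q μ) (hg : MemLp g p μ)
    (h : Tendsto (fun n => eLpNorm (f n - f₀) q μ) atTop (𝓝 0)) :
    Tendsto (fun n => ∫ x, L (f n x) (g x) ∂μ) atTop (𝓝 (∫ x, L (f₀ x) (g x) ∂μ)) := by
  refine tendsto_integral_of_L1' _ (L.memLp_of_bilin 1 hf₀ hg).1
    (Eventually.of_forall fun n => memLp_one_iff_integrable.1 (L.memLp_of_bilin 1 (hf n) hg)) ?_
  have holder (n : ℕ) : eLpNorm ((fun x => L (f n x) (g x)) - fun x => L (f₀ x) (g x)) 1 μ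
      ≤ ‖L‖₊ * eLpNorm (f n - f₀) q μ * eLpNorm g p μ := by
    have sub_eq : ((fun x => L (f n x) (g x)) - fun x => L (f₀ x) (g x))
        = fun x => L ((f n - f₀) x) (g x) := by
      funext x
      simp
    rw [sub_eq]
    exact eLpNorm_le_eLpNorm_mul_eLpNorm_of_nnnorm ((hf n).1.sub hf₀.1) hg.1 (L · ·) ‖L‖₊
      (ae_of_all _ fun x => L.le_opNorm₂ _ _)
  have bound_tendsto : Tendsto (fun n => ‖L‖₊ * eLpNorm (f n - f₀) q μ * eLpNorm g p μ) atTop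
      (𝓝 0) := by
    simpa using ENNReal.Tendsto.mul_const
      (ENNReal.Tendsto.const_mul h (Or.inr ENNReal.coe_ne_top)) (Or.inr hg.2.ne)
  exact tendsto_of_tendsto_of_tendsto_of_le_of_le tendsto_const_nhds bound_tendsto
    (fun _ => zero_le) holder

variable {Ω : Set R3} {p q : ℝ≥0∞} {F G : R3 → C3}

lemma memLp_of_mem_smoothTests {t : (R3 → ℂ) × (R3 → C3)} (ht : t ∈ smoothTests Ω) :
    MemLp t.1 q (volume.restrict Ω) ∧ MemLp t.2 q (volume.restrict Ω) := by
  obtain ⟨hφ, hg⟩ := mem_smoothTests_iff.1 ht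
  refine ⟨hφ.contDiff.continuous.memLp_of_hasCompactSupport hφ.hasCompactSupport, ?_⟩
  rw [hg]
  exact MemLp.of_eval fun i => (hφ.dirDeriv (e i)).contDiff.continuous.memLp_of_hasCompactSupport
    (hφ.dirDeriv (e i)).hasCompactSupport

lemma smoothTests_subset_sobolevTests (Ω : Set R3) (q : ℝ≥0∞) :
    smoothTests Ω ⊆ sobolevTests Ω q := by
  rintro ⟨φ, ψ⟩ ht
  obtain ⟨hφ, hψ⟩ := memLp_of_mem_smoothTests (q := q) ht
  obtain rfl := (mem_smoothTests_iff.1 ht).2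
  exact ⟨hφ, hψ, fun _ => φ, fun _ => ht, by simp, by simp⟩

lemma weakCurl_sobolevTests_iff [ENNReal.HolderTriple q p 1]
    (hF : MemLp F p (volume.restrict Ω)) (hG : MemLp G p (volume.restrict Ω)) :
    WeakCurl (sobolevTests Ω q) Ω F G ↔ WeakCurl (smoothTests Ω) Ω F G := by
  refine ⟨fun h t ht => h t (smoothTests_subset_sobolevTests Ω q ht), fun h t ht => ?_⟩
  obtain ⟨hv, hgrad, φ, hφ, φ_tendsto, grad_tendsto⟩ := ht
  have φ_mem (n : ℕ) := memLp_of_mem_smoothTests (q := q) (hφ n)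
  have lhs := tendsto_integral_bilin (ContinuousLinearMap.lsmul ℂ ℂ) (fun n => (φ_mem n).1) hv hG
    φ_tendsto
  have rhs := tendsto_integral_bilin (crossProduct (R := ℂ)).toContinuousBilinearMap
    (fun n => (φ_mem n).2) hgrad hF grad_tendsto
  exact tendsto_nhds_unique lhs (rhs.neg.congr fun n => (h _ (hφ n)).symm)

lemma weakDiv_sobolevTests_iff [ENNReal.HolderTriple q p 1] {d : R3 → ℂ}
    (hF : MemLp F p (volume.restrict Ω)) (hd : MemLp d p (volume.restrict Ω)) :
    WeakDiv (sobolevTests Ω q) Ω F d ↔ WeakDiv (smoothTests Ω) Ω F d := by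
  refine ⟨fun h t ht => h t (smoothTests_subset_sobolevTests Ω q ht), fun h t ht => ?_⟩
  obtain ⟨hv, hgrad, φ, hφ, φ_tendsto, grad_tendsto⟩ := ht
  have φ_mem (n : ℕ) := memLp_of_mem_smoothTests (q := q) (hφ n)
  have lhs := tendsto_integral_bilin (ContinuousLinearMap.mul ℂ ℂ) (fun n => (φ_mem n).1) hv hd
    φ_tendsto
  have rhs := tendsto_integral_bilin (dotProductBilin ℂ ℂ).toContinuousBilinearMap
    (fun n => (φ_mem n).2) hgrad hF grad_tendsto
  exact tendsto_nhds_unique lhs (rhs.neg.congr fun n => (h _ (hφ n)).symm)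

lemma weakMaxwell_sobolevTests_iff [ENNReal.HolderTriple q p 1] {ω ε μ : ℂ} {ρ : R3 → ℂ}
    {j E H : R3 → C3} (hj : MemLp j p (volume.restrict Ω)) (hρ : MemLp ρ p (volume.restrict Ω))
    (hE : MemLp E p (volume.restrict Ω)) (hH : MemLp H p (volume.restrict Ω)) :
    WeakMaxwell (sobolevTests Ω q) Ω ω ε μ ρ j E H ↔
      WeakMaxwell (smoothTests Ω) Ω ω ε μ ρ j E H := by
  have curl_H_iff := weakCurl_sobolevTests_iff (q := q) hH
    ((hE.const_smul (-(Complex.I * ω * ε))).add hj)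
  have div_H_iff := weakDiv_sobolevTests_iff (q := q) hH (MemLp.zero' (ε := ℂ))
  have curl_E_iff := weakCurl_sobolevTests_iff (q := q) hE (hH.const_smul (Complex.I * ω * μ))
  have div_E_iff := weakDiv_sobolevTests_iff (q := q) hE (hρ.mul_const ε⁻¹)
  exact ⟨fun ⟨h₁, h₂, h₃, h₄⟩ =>
      ⟨curl_H_iff.1 h₁, div_H_iff.1 h₂, curl_E_iff.1 h₃, div_E_iff.1 h₄⟩,
    fun ⟨h₁, h₂, h₃, h₄⟩ =>
      ⟨curl_H_iff.2 h₁, div_H_iff.2 h₂, curl_E_iff.2 h₃, div_E_iff.2 h₄⟩⟩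

end Sobolev

/-! ### The representation formula -/

section Representation

variable {Ω : Set R3} {p : ℝ≥0∞} {ω ε μ lam : ℂ} {j E H S₁ S₂ : R3 → C3}

lemma weakMaxwell_smoothTests_iff (hω : ω ≠ 0) (hε : ε ≠ 0) (hμ : μ ≠ 0) {divj ρ : R3 → ℂ}
    (hρ : ρ = fun x => 1 / (Complex.I * ω) * divj x) (hj : LocallyIntegrableOn j Ω)
    (hd : LocallyIntegrableOn divj Ω) (hdiv : WeakDiv (smoothTests Ω) Ω j divj)
    (hE : LocallyIntegrableOn E Ω) (hH : LocallyIntegrableOn H Ω) :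
    WeakMaxwell (smoothTests Ω) Ω ω ε μ ρ j E H ↔
      VectorDistr.curl (ofField Ω H) = -(Complex.I * ω * ε) • ofField Ω E + ofField Ω j ∧
      VectorDistr.curl (ofField Ω E) = (Complex.I * ω * μ) • ofField Ω H := by
  have charge_eq : (fun x => ρ x / ε) = (1 / (Complex.I * ω * ε)) • divj := by
    funext x
    simp only [hρ, Pi.smul_apply, smul_eq_mul]
    field_simp
  have curl_H_iff := weakCurl_smoothTests_iff hH ((hE.smul (-(Complex.I * ω * ε))).add hj)
  have curl_E_iff := weakCurl_smoothTests_iff hE (hH.smul (Complex.I * ω * μ))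
  rw [VectorDistr.ofField_add (hE.smul _) hj, VectorDistr.ofField_smul hE] at curl_H_iff
  rw [VectorDistr.ofField_smul hH] at curl_E_iff
  refine ⟨fun h => ⟨curl_H_iff.1 h.curl_H, curl_E_iff.1 h.curl_E⟩, fun ⟨hcH, hcE⟩ =>
    ⟨curl_H_iff.2 hcH, ?_, curl_E_iff.2 hcE, ?_⟩⟩
  · refine (weakDiv_smoothTests_iff hH (locallyIntegrableOn_const 0)).2
      (Eq.trans ?_ Distr.ofFun_zero.symm)
    have := VectorDistr.div_curl (ofField Ω E)
    rwa [hcE, map_smul, smul_eq_zero_iff_right (by simp [hω, hμ])] at this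
  · rw [charge_eq, weakDiv_smoothTests_iff hE (hd.smul _), Distr.ofFun_smul hd,
      ← (weakDiv_smoothTests_iff hj hd).1 hdiv, one_div, eq_inv_smul_iff₀ (by simp [hω, hε])]
    have := VectorDistr.div_curl (ofField Ω H)
    rwa [hcH, map_add, map_smul, neg_smul, neg_add_eq_zero] at this

lemma curl_eq_iff_forceFree {a b : ℂ} (hlam : lam ≠ 0) (ha : a ≠ 0) (hab : a * b = -lam ^ 2)
    {U : Set R3} {E H J S₁ S₂ : VectorDistr U}
    (h₁ : VectorDistr.curl (J - S₁) = lam • S₁) (h₂ : VectorDistr.curl (J - S₂) = -lam • S₂) :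
    (VectorDistr.curl H = -a • E + J ∧ VectorDistr.curl E = b • H) ↔
      VectorDistr.curl (a • E + lam • H - (J - S₁)) = -lam • (a • E + lam • H - (J - S₁)) ∧
      VectorDistr.curl (lam • H - a • E + (J - S₂)) = lam • (lam • H - a • E + (J - S₂)) := by
  have sum_eq : a • (VectorDistr.curl E - b • H) + lam • (VectorDistr.curl H - (-a • E + J))
      = VectorDistr.curl (a • E + lam • H - (J - S₁)) - -lam • (a • E + lam • H - (J - S₁)) := by
    rw [map_sub, h₁, map_add, map_smul, map_smul, smul_sub a, smul_smul a, hab]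
    module
  have difference_eq :
      lam • (VectorDistr.curl H - (-a • E + J)) - a • (VectorDistr.curl E - b • H)
        = VectorDistr.curl (lam • H - a • E + (J - S₂))
          - lam • (lam • H - a • E + (J - S₂)) := by
    rw [map_add, h₂, map_sub, map_smul, map_smul, smul_sub a, smul_smul a, hab]
    module
  rw [← sub_eq_zero, ← sub_eq_zero (b := b • H), ← sub_eq_zero (b := -lam • _),
    ← sub_eq_zero (b := lam • (lam • H - a • E + (J - S₂))), ← sum_eq, ← difference_eq]
  refine ⟨fun ⟨hH, hE⟩ => by simp only [hH, hE, smul_zero, add_zero, sub_zero, and_self],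
    fun ⟨hsum, hdiff⟩ => ?_⟩
  have curl_E_zero : (2 : ℂ) • a • (VectorDistr.curl E - b • H) = 0 := by
    linear_combination (norm := module) hsum - hdiff
  rw [smul_eq_zero_iff_right two_ne_zero, smul_eq_zero_iff_right ha] at curl_E_zero
  rw [curl_E_zero, smul_zero, zero_add, smul_eq_zero_iff_right hlam] at hsum
  exact ⟨hsum, curl_E_zero⟩

lemma representation_iff {a : ℂ} (ha : a ≠ 0) (hlam : lam ≠ 0) {V : Type*} [AddCommGroup V]
    [Module ℂ V] {E H J S₁ S₂ u v : V} :
    (E = (1 / (2 * a)) • ((2 : ℂ) • J - (S₁ + S₂)) + (1 / (2 * a)) • (u - v) ∧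
      H = -((1 / (2 * lam)) • (S₁ - S₂)) + (1 / (2 * lam)) • (u + v)) ↔
      a • E + lam • H - (J - S₁) = u ∧ lam • H - a • E + (J - S₂) = v := by
  have ha' : a * (1 / (2 * a)) = 1 / 2 := by field_simp
  have hlam' : lam * (1 / (2 * lam)) = 1 / 2 := by field_simp
  constructor
  · rintro ⟨rfl, rfl⟩
    simp only [smul_add, smul_neg, smul_smul, ha', hlam']
    constructor <;> module
  · rintro ⟨rfl, rfl⟩
    constructor
    · refine smul_right_injective V ha ?_
      simp only [smul_add, smul_smul, ha']
      module
    · refine smul_right_injective V hlam ?_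
      simp only [smul_add, smul_neg, smul_smul, hlam']
      module

lemma hasRepresentation_iff (hω : ω ≠ 0) (hε : ε ≠ 0) (hlam : lam ≠ 0) :
    HasRepresentation Ω ω ε lam j (S₁ + S₂) (S₁ - S₂) E H ↔
      (∃ u, IsForceFree Ω lam u ∧
        (Complex.I * ω * ε) • E + lam • H - (j - S₁) =ᵐ[volume.restrict Ω] u) ∧
      ∃ v, IsForceFree Ω (-lam) v ∧
        lam • H - (Complex.I * ω * ε) • E + (j - S₂) =ᵐ[volume.restrict Ω] v := by
  have ha : Complex.I * ω * ε ≠ 0 := by simp [hω, hε]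
  have pointwise (u v : R3 → C3) (x : R3) := representation_iff ha hlam (E := E x) (H := H x)
    (J := j x) (S₁ := S₁ x) (S₂ := S₂ x) (u := u x) (v := v x)
  simp only [HasRepresentation, ← eventually_and, Pi.add_apply, Pi.sub_apply]
  simp only [← mul_assoc] at pointwise
  simp only [pointwise, eventually_and]
  exact ⟨fun ⟨u, v, hu, hv, hu_eq, hv_eq⟩ => ⟨⟨u, hu, hu_eq⟩, v, hv, hv_eq⟩,
    fun ⟨⟨u, hu, hu_eq⟩, v, hv, hv_eq⟩ => ⟨u, v, hu, hv, hu_eq, hv_eq⟩⟩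

lemma MemLpLoc.congr_ae {F G : R3 → C3} (hF : MemLpLoc F p Ω) (h : F =ᵐ[volume.restrict Ω] G) :
    MemLpLoc G p Ω :=
  fun K hK hKc => (hF K hK hKc).ae_eq (ae_restrict_of_ae_restrict_of_subset hK h)

lemma MemLpLoc.add {F G : R3 → C3} (hF : MemLpLoc F p Ω) (hG : MemLpLoc G p Ω) :
    MemLpLoc (F + G) p Ω :=
  fun K hK hKc => (hF K hK hKc).add (hG K hK hKc)

lemma MemLpLoc.sub {F G : R3 → C3} (hF : MemLpLoc F p Ω) (hG : MemLpLoc G p Ω) :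
    MemLpLoc (F - G) p Ω :=
  fun K hK hKc => (hF K hK hKc).sub (hG K hK hKc)

lemma memLpLoc_of_memLp {F : R3 → C3} (hF : MemLp F p (volume.restrict Ω)) : MemLpLoc F p Ω :=
  fun _ hK _ => hF.mono_measure (Measure.restrict_mono hK le_rfl)

lemma IsForceFree.memLpLoc {κ : ℂ} {u : R3 → C3} (hu : IsForceFree Ω κ u) : MemLpLoc u p Ω := by
  intro K hK hKc
  have hu_cont : ContinuousOn u K := hu.contDiffOn.continuousOn.mono hK
  have : IsFiniteMeasure (volume.restrict K) := ⟨by simpa using hKc.measure_lt_top⟩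
  obtain ⟨C, hC⟩ := hKc.exists_bound_of_continuousOn hu_cont
  exact MemLp.of_bound (hu_cont.aestronglyMeasurable_of_isCompact hKc hKc.measurableSet) C
    (ae_restrict_of_forall_mem hKc.measurableSet hC)

lemma HasRepresentation.memLpLoc {S Δ : R3 → C3} (hj : MemLpLoc j p Ω) (hS : MemLpLoc S p Ω)
    (hΔ : MemLpLoc Δ p Ω) (h : HasRepresentation Ω ω ε lam j S Δ E H) :
    MemLpLoc E p Ω ∧ MemLpLoc H p Ω := by
  obtain ⟨u, v, hu, hv, hE, hH⟩ := h
  refine ⟨MemLpLoc.congr_ae (fun K hK hKc => ?_) (EventuallyEq.symm hE),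
    MemLpLoc.congr_ae (fun K hK hKc => ?_) (EventuallyEq.symm hH)⟩
  · exact ((((hj K hK hKc).const_smul (2 : ℂ)).sub (hS K hK hKc)).const_smul
      (1 / (2 * Complex.I * ω * ε))).add
        (((hu.memLpLoc K hK hKc).sub (hv.memLpLoc K hK hKc)).const_smul
          (1 / (2 * Complex.I * ω * ε)))
  · exact ((hΔ K hK hKc).const_smul (1 / (2 * lam))).neg.add
      (((hu.memLpLoc K hK hKc).add (hv.memLpLoc K hK hKc)).const_smul (1 / (2 * lam)))

lemma weakMaxwell_iff_hasRepresentation_of_memLpLoc (hp : 1 ≤ p) (hΩ : IsOpen Ω) (hω : ω ≠ 0)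
    (hε : ε ≠ 0) (hμ : μ ≠ 0) (hlam : lam ^ 2 = ω ^ 2 * (ε * μ)) {divj ρ : R3 → ℂ}
    (hj : MemWDiv Ω p j divj) (hρ : ρ = fun x => 1 / (Complex.I * ω) * divj x)
    (hS₁ : MemLpLoc S₁ p Ω) (hS₂ : MemLpLoc S₂ p Ω)
    (h₁ : VectorDistr.curl (ofField Ω j - ofField Ω S₁) = lam • ofField Ω S₁)
    (h₂ : VectorDistr.curl (ofField Ω j - ofField Ω S₂) = -lam • ofField Ω S₂)
    (hE : MemLpLoc E p Ω) (hH : MemLpLoc H p Ω) :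
    WeakMaxwell (smoothTests Ω) Ω ω ε μ ρ j E H ↔
      HasRepresentation Ω ω ε lam j (S₁ + S₂) (S₁ - S₂) E H := by
  have hlam0 : lam ≠ 0 := by
    rw [← pow_ne_zero_iff two_ne_zero, hlam]
    simp [hω, hε, hμ]
  have hab : Complex.I * ω * ε * (Complex.I * ω * μ) = -lam ^ 2 := by
    rw [hlam]
    linear_combination ω ^ 2 * ε * μ * Complex.I_sq
  have j_loc := (memLpLoc_of_memLp hj.1).locallyIntegrableOn hp hΩ
  have S₁_loc := hS₁.locallyIntegrableOn hp hΩ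
  have S₂_loc := hS₂.locallyIntegrableOn hp hΩ
  have E_loc := hE.locallyIntegrableOn hp hΩ
  have H_loc := hH.locallyIntegrableOn hp hΩ
  have aE_loc := E_loc.smul (Complex.I * ω * ε)
  have lamH_loc := H_loc.smul lam
  have divj_loc : LocallyIntegrableOn divj Ω := locallyIntegrableOn_of_memLp_isCompact hp hΩ
    fun K hK _ => hj.2.1.mono_measure (Measure.restrict_mono hK le_rfl)
  rw [weakMaxwell_smoothTests_iff hω hε hμ hρ j_loc divj_loc hj.2.2 E_loc H_loc,
    curl_eq_iff_forceFree hlam0 (by simp [hω, hε]) hab h₁ h₂, hasRepresentation_iff hω hε hlam0,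
    exists_isForceFree_ae_eq_iff hΩ ((aE_loc.add lamH_loc).sub (j_loc.sub S₁_loc)) hlam0,
    exists_isForceFree_ae_eq_iff hΩ ((lamH_loc.sub aE_loc).add (j_loc.sub S₂_loc))
      (neg_ne_zero.2 hlam0),
    neg_neg, VectorDistr.ofField_sub (aE_loc.add lamH_loc) (j_loc.sub S₁_loc),
    VectorDistr.ofField_add (lamH_loc.sub aE_loc) (j_loc.sub S₂_loc),
    VectorDistr.ofField_add aE_loc lamH_loc, VectorDistr.ofField_sub lamH_loc aE_loc,
    VectorDistr.ofField_sub j_loc S₁_loc, VectorDistr.ofField_sub j_loc S₂_loc,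
    VectorDistr.ofField_smul E_loc, VectorDistr.ofField_smul H_loc]

theorem weakMaxwell_iff_hasRepresentation (hp : 1 ≤ p) (hΩ : IsOpen Ω) (hω : ω ≠ 0) (hε : ε ≠ 0)
    (hμ : μ ≠ 0) (hlam : lam ^ 2 = ω ^ 2 * (ε * μ)) {divj ρ : R3 → ℂ} (hj : MemWDiv Ω p j divj)
    (hρ : ρ = fun x => 1 / (Complex.I * ω) * divj x)
    (hS₁ : MemLpLoc S₁ p Ω) (hS₂ : MemLpLoc S₂ p Ω)
    (h₁ : VectorDistr.curl (ofField Ω j - ofField Ω S₁) = lam • ofField Ω S₁)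
    (h₂ : VectorDistr.curl (ofField Ω j - ofField Ω S₂) = -lam • ofField Ω S₂) :
    (MemLpLoc E p Ω ∧ MemLpLoc H p Ω ∧ WeakMaxwell (smoothTests Ω) Ω ω ε μ ρ j E H) ↔
      HasRepresentation Ω ω ε lam j (S₁ + S₂) (S₁ - S₂) E H := by
  have key (hE : MemLpLoc E p Ω) (hH : MemLpLoc H p Ω) :=
    weakMaxwell_iff_hasRepresentation_of_memLpLoc hp hΩ hω hε hμ hlam hj hρ hS₁ hS₂ h₁ h₂ hE hH
  refine ⟨fun ⟨hE, hH, h⟩ => (key hE hH).1 h, fun h => ?_⟩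
  obtain ⟨hE, hH⟩ := h.memLpLoc (memLpLoc_of_memLp hj.1) (hS₁.add hS₂) (hS₁.sub hS₂)
  exact ⟨hE, hH, (key hE hH).2 h⟩

end Representation

end MaxwellWeak

open MaxwellWeak in
theorem mainTheorem4_general (Ω : Set R3) (hΩ : IsOpen Ω) (hb : Bornology.IsBounded Ω)
    (p q : ℝ≥0∞) (hpq : 1 / p + 1 / q = 1)
    (ω ε μ lam : ℂ) (hω : ω ≠ 0) (hε : ε ≠ 0) (hμ : μ ≠ 0) (hlam : lam ^ 2 = ω ^ 2 * (ε * μ))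
    (j : R3 → C3) (divj : R3 → ℂ) (hj : MemWDiv Ω p j divj)
    (ρ : R3 → ℂ) (hρ : ρ = fun x => 1 / (Complex.I * ω) * divj x) :
    (∀ κ ∈ ({lam, -lam} : Set ℂ), ∀ᵐ x ∂(volume.restrict Ω),
      IntegrableOn (teodorescuIntegrand lam κ j x) Ω) ∧
    ∃ S Δ : R3 → C3,
      MemLpLoc (teodorescuTwo Ω lam lam j) p Ω ∧ MemLpLoc (teodorescuTwo Ω lam (-lam) j) p Ω ∧
      MemLpLoc S p Ω ∧ MemLpLoc Δ p Ω ∧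
      WeakCurl (smoothTests Ω) Ω
        (teodorescuTwo Ω lam lam j + teodorescuTwo Ω lam (-lam) j) S ∧
      WeakCurl (smoothTests Ω) Ω
        (teodorescuTwo Ω lam lam j - teodorescuTwo Ω lam (-lam) j) Δ ∧
      (∀ E H : R3 → C3,
        (MemLpLoc E p Ω ∧ MemLpLoc H p Ω ∧ WeakMaxwell (smoothTests Ω) Ω ω ε μ ρ j E H) ↔
        HasRepresentation Ω ω ε lam j S Δ E H) ∧
      (∀ E H : R3 → C3, MemLp E p (volume.restrict Ω) → MemLp H p (volume.restrict Ω) →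
        (WeakMaxwell (sobolevTests Ω q) Ω ω ε μ ρ j E H ↔
          HasRepresentation Ω ω ε lam j S Δ E H)) := by
  have : ENNReal.HolderTriple q p 1 := ⟨by rw [inv_one, add_comm, ← one_div, ← one_div, hpq]⟩
  have hp : 1 ≤ p := by simpa using le_self_add.trans_eq hpq
  obtain ⟨S, hS⟩ := exists_curl_teodorescuTwo hp hΩ hb hj
  obtain ⟨integrable₁, T₁, S₁, curl_T₁, curl_S₁⟩ := hS lam rfl
  obtain ⟨integrable₂, T₂, S₂, curl_T₂, curl_S₂⟩ := hS (-lam) (neg_sq lam)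
  have T₁_loc := T₁.locallyIntegrableOn hp hΩ
  have T₂_loc := T₂.locallyIntegrableOn hp hΩ
  have S₁_loc := S₁.locallyIntegrableOn hp hΩ
  have S₂_loc := S₂.locallyIntegrableOn hp hΩ
  have hρ_mem : MemLp ρ p (volume.restrict Ω) := hρ ▸ hj.2.1.const_mul _
  have interior_iff (E H : R3 → C3) := weakMaxwell_iff_hasRepresentation (E := E) (H := H)
    hp hΩ hω hε hμ hlam hj hρ S₁ S₂ curl_S₁ curl_S₂
  refine ⟨by rintro κ (rfl | rfl) <;> assumption, S lam + S (-lam), S lam - S (-lam), T₁, T₂,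
    S₁.add S₂, S₁.sub S₂, ?_, ?_, interior_iff, fun E H hE hH => ?_⟩
  · rw [weakCurl_smoothTests_iff (T₁_loc.add T₂_loc) (S₁_loc.add S₂_loc),
      VectorDistr.ofField_add T₁_loc T₂_loc, VectorDistr.ofField_add S₁_loc S₂_loc, map_add,
      curl_T₁, curl_T₂]
  · rw [weakCurl_smoothTests_iff (T₁_loc.sub T₂_loc) (S₁_loc.sub S₂_loc),
      VectorDistr.ofField_sub T₁_loc T₂_loc, VectorDistr.ofField_sub S₁_loc S₂_loc, map_sub,
      curl_T₁, curl_T₂]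
  · rw [weakMaxwell_sobolevTests_iff hj.1 hρ_mem hE hH, ← interior_iff]
    simp only [memLpLoc_of_memLp hE, memLpLoc_of_memLp hH, true_and]

end

theorem mainTheorem4
    (Ω : Set MaxwellWeak.R3) (hΩ : MaxwellWeak.IsLiapunovDomain Ω)
    (p q : ℝ≥0∞) (hp : 1 < p) (hp_top : p < ⊤) (hpq : 1 / p + 1 / q = 1)
    (ω ε μ lam : ℂ) (hω : ω ≠ 0) (hε : ε ≠ 0) (hμ : μ ≠ 0)
    (hlam : lam ^ 2 = ω ^ 2 * (ε * μ)) (hlam_im : 0 ≤ lam.im)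
    (j : MaxwellWeak.R3 → MaxwellWeak.C3) (divj : MaxwellWeak.R3 → ℂ)
    (hj : MaxwellWeak.MemWDiv Ω p j divj)
    (ρ : MaxwellWeak.R3 → ℂ) (hρ : ρ = fun x => 1 / (Complex.I * ω) * divj x) :
    (∀ κ ∈ ({lam, -lam} : Set ℂ), ∀ᵐ x ∂(volume.restrict Ω),
      IntegrableOn (MaxwellWeak.teodorescuIntegrand lam κ j x) Ω) ∧
    ∃ S Δ : MaxwellWeak.R3 → MaxwellWeak.C3,
      MaxwellWeak.MemLpLoc (MaxwellWeak.teodorescuTwo Ω lam lam j) p Ω ∧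
      MaxwellWeak.MemLpLoc (MaxwellWeak.teodorescuTwo Ω lam (-lam) j) p Ω ∧
      MaxwellWeak.MemLpLoc S p Ω ∧ MaxwellWeak.MemLpLoc Δ p Ω ∧
      MaxwellWeak.WeakCurl (MaxwellWeak.smoothTests Ω) Ω
        (MaxwellWeak.teodorescuTwo Ω lam lam j + MaxwellWeak.teodorescuTwo Ω lam (-lam) j) S ∧
      MaxwellWeak.WeakCurl (MaxwellWeak.smoothTests Ω) Ω
        (MaxwellWeak.teodorescuTwo Ω lam lam j - MaxwellWeak.teodorescuTwo Ω lam (-lam) j) Δ ∧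
      (∀ E H : MaxwellWeak.R3 → MaxwellWeak.C3,
        (MaxwellWeak.MemLpLoc E p Ω ∧ MaxwellWeak.MemLpLoc H p Ω ∧
          MaxwellWeak.WeakMaxwell (MaxwellWeak.smoothTests Ω) Ω ω ε μ ρ j E H) ↔
        MaxwellWeak.HasRepresentation Ω ω ε lam j S Δ E H) ∧
      (∀ E H : MaxwellWeak.R3 → MaxwellWeak.C3,
        MemLp E p (volume.restrict Ω) → MemLp H p (volume.restrict Ω) →
        (MaxwellWeak.WeakMaxwell (MaxwellWeak.sobolevTests Ω q) Ω ω ε μ ρ j E H ↔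
          MaxwellWeak.HasRepresentation Ω ω ε lam j S Δ E H)) :=
  mainTheorem4_general Ω hΩ.isOpen hΩ.isBounded p q hpq ω ε μ lam hω hε hμ hlam j divj hj ρ hρ
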